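/- **Setting.** Let $S^0,S^1,\dots$ be i.i.d. potential services with values in $\{0,1,\dots,S_{\max}\}$, mean $\mu>0$ and variance $\sigma_s^2$. For each $\epsilon\in(0,\mu)$ let $\{X^{t}\}=\{(X^t)^{(\epsilon)}\}_{t\ge 0}$ be an irreducible, aperiodic Markov chain on a finite state space $\Omega^{(\epsilon)}$, independent of the services, with stationary distribution $\pi^{(\epsilon)}$, and let the arrivals be $A^t=f^{(\epsilon)}(X^t)$ with $f^{(\epsilon)}:\Omega^{(\epsilon)}\to\{0,1,\dots,A_{\max}\}$, where $A_{\max}$ does not depend on $\epsilon$ and $\sum_x \pi^{(\epsilon)}(x)f^{(\epsilon)}(x)=\lambda^{(\epsilon)}=\mu-\epsilon$. The queue length evolves in $\{0,1,2,\dots\}$ by $$Q^{t+1}=\max\{Q^t+A^t-S^t,\,0\}.$$ For each $\epsilon$, assume that the two-dimensional Markov chain $\{(Q^t,X^t)\}$ is irreducible and aperiodic on its state space $\mathcal S^{(\epsilon)}\subseteq\mathbb N\times\Omega^{(\epsilon)}$. Assume that there are numbers $\alpha^{(\epsilon)}\in(0,1)$ and $C^{(\epsilon)}>0$ such that for all $m\ge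 1$ and every initial distribution $\pi^0$ on $\Omega^{(\epsilon)}$ $$\bigl|E[f^{(\epsilon)}(X^m)-\lambda^{(\epsilon)}\mid X^0\sim\pi^0]\bigr|\le 2\Bigl(\max_x f^{(\epsilon)}(x)\Bigr)C^{(\epsilon)}(\alpha^{(\epsilon)})^m ,$$ and that $\sup_\epsilon\alpha^{(\epsilon)}\le\alpha<1$ and $\sup_\epsilon C^{(\epsilon)}\le C<\infty$. Let $$\gamma^{(\epsilon)}(t)=E\bigl[(A^t-\lambda^{(\epsilon)})(A^0-\lambda^{(\epsilon)})\mid X^0\sim\pi^{(\epsilon)}\bigr],$$ assume that $\lim_{\epsilon\downarrow0}\gamma^{(\epsilon)}(t)=\gamma(t)$ exists for every $t\in\mathbb N$, and let $\sigma_a^2=\gamma(0)+2\lim_{m\to\infty}\sum_{t=1}^m\gamma(t)$. **Theorem.** Under these assumptions: 1. For each $\epsilon\in(0,\mu)$ the chain $\{(Q^t,X^t)\}$ is positive recurrent: the mean return time of every state of $\mathcal S^{(\epsilon)}$ is finite. 2. For each $\epsilon\in(0,\mu)$ there is a steady-state queue length $\overline Q^{(\epsilon)}$ (its law is the first marginal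 of a stationary distribution of the chain on $\mathcal S^{(\epsilon)}$) to which $Q^t$ converges in distribution as $t\to\infty$, for every initial distribution on $\mathcal S^{(\epsilon)}$. Moreover $E[\overline Q^{(\epsilon)}]<\infty$, the limit defining $\sigma_a^2$ exists and is finite, and $$\lim_{\epsilon\downarrow0}E\bigl[\epsilon\,\overline Q^{(\epsilon)}\bigr]=\frac{\sigma_a^2+\sigma_s^2}{2}.$$ -/

import Mathlib

open MeasureTheory ProbabilityTheory Filter Topology
open scoped ENNReal

noncomputable section

namespace MarkovQueue

section Chains

variable {E : Type*} [MeasurableSpace E]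

/-- The law, on trajectory space `ℕ → E`, of the time-homogeneous Markov chain with transition
kernel `K` and initial distribution `ν₀`. The state at time `t` is the coordinate `ω t`. -/
def chainLaw (K : Kernel E E) [IsMarkovKernel K] (ν₀ : Measure E) : Measure (ℕ → E) :=
  Kernel.trajMeasure (X := fun _ => E) ν₀
    (fun n => K.comap (fun h : (i : Finset.Iic n) → E => h ⟨n, Finset.mem_Iic.2 le_rfl⟩)
      (measurable_pi_apply _))

instance (K : Kernel E E) [IsMarkovKernel K] (ν₀ : Measure E) [IsProbabilityMeasure ν₀] :
    IsProbabilityMeasure (chainLaw K ν₀) := by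
  unfold chainLaw
  infer_instance

/-- The `n`-step transition probability from `z` to `w`. -/
def stepProb (K : Kernel E E) [IsMarkovKernel K] (n : ℕ) (z w : E) : ℝ≥0∞ :=
  chainLaw K (Measure.dirac z) {ω | ω n = w}

/-- The chain with kernel `K`, regarded as a chain with state space `S`, is irreducible: `S` is
nonempty, the chain does not leave `S`, and any two states of `S` communicate. -/
structure IsIrreducibleOn (K : Kernel E E) [IsMarkovKernel K] (S : Set E) : Prop where
  nonempty : S.Nonempty
  closed : ∀ z ∈ S, K z Sᶜ = 0
  communicate : ∀ z ∈ S, ∀ w ∈ S, ∃ n : ℕ, 0 < stepProb K n z w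

/-- Aperiodicity on the state space `S`: for every `z ∈ S`, the greatest common divisor of
`{n ≥ 1 : Pⁿ(z, z) > 0}` is `1`. -/
def IsAperiodicOn (K : Kernel E E) [IsMarkovKernel K] (S : Set E) : Prop :=
  ∀ z ∈ S, ∀ d : ℕ, (∀ n : ℕ, 1 ≤ n → 0 < stepProb K n z z → d ∣ n) → d = 1

/-- The first time `n ≥ 1` at which the trajectory `ω` is in `z`, with value `∞` if there is
none. -/
def returnTime (z : E) (ω : ℕ → E) : ℝ≥0∞ :=
  ⨅ n : ℕ, ⨅ _ : 1 ≤ n ∧ ω n = z, (n : ℝ≥0∞)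

/-- Positive recurrence on the state space `S`: every state of `S` has a finite mean return
time. -/
def IsPositiveRecurrentOn (K : Kernel E E) [IsMarkovKernel K] (S : Set E) : Prop :=
  ∀ z ∈ S, ∫⁻ ω, returnTime z ω ∂(chainLaw K (Measure.dirac z)) < ∞

end Chains

section Arrivals

variable {Ω : Type*} [MeasurableSpace Ω]

/-- Geometric mixing with parameters `α` and `C` of the arrival process `Aᵗ = f (Xᵗ)`: for every
initial distribution of `X⁰` and every `m ≥ 1`, `|E[f (Xᵐ) - lam]| ≤ 2 L C αᵐ`, where
`L = max f`. -/
def GeometricMixing [Fintype Ω] (P : Kernel Ω Ω) [IsMarkovKernel P] (f : Ω → ℕ)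
    (lam α C : ℝ) : Prop :=
  ∀ m : ℕ, 1 ≤ m → ∀ π₀ : ProbabilityMeasure Ω,
    |∫ ω, ((f (ω m) : ℝ) - lam) ∂(chainLaw P (π₀ : Measure Ω))|
      ≤ 2 * ((Finset.univ.sup f : ℕ) : ℝ) * C * α ^ m

/-- The autocorrelation `E[(Aᵗ - lam) (A⁰ - lam)]` of `Aᵗ = f (Xᵗ)`, with `X⁰` distributed
as `π`. -/
def autocorr (P : Kernel Ω Ω) [IsMarkovKernel P] (f : Ω → ℕ) (π : Measure Ω) (lam : ℝ)
    (t : ℕ) : ℝ :=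
  ∫ ω, ((f (ω t) : ℝ) - lam) * ((f (ω 0) : ℝ) - lam) ∂(chainLaw P π)

/-- The transition kernel of the queue `(Qᵗ, Xᵗ)`: from `(q, x)` the chain moves to
`(max (q + f x - s) 0, x')`, where the potential service `s` has law `ν`, the next state `x'` of
the modulating chain has law `P x`, and `s` and `x'` are independent. The subtraction is the
truncated subtraction of natural numbers, that is, it includes the maximum with `0`. -/
def queueKernel [Countable Ω] [MeasurableSingletonClass Ω] (P : Kernel Ω Ω) (f : Ω → ℕ)
    (ν : Measure ℕ) : Kernel (ℕ × Ω) (ℕ × Ω) where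
  toFun z := (ν.prod (P z.2)).map (fun w : ℕ × Ω => (z.1 + f z.2 - w.1, w.2))
  measurable' := Measurable.of_discrete

instance [Countable Ω] [MeasurableSingletonClass Ω] (P : Kernel Ω Ω) [IsMarkovKernel P]
    (f : Ω → ℕ) (ν : Measure ℕ) [IsProbabilityMeasure ν] :
    IsMarkovKernel (queueKernel P f ν) :=
  ⟨fun _ => Measure.isProbabilityMeasure_map Measurable.of_discrete.aemeasurable⟩

end Arrivals

end MarkovQueue

end

open MarkovQueue

/-!
Fix `ε` and write `lam = μ - ε`. Geometric mixing makes `h x = ∑ₜ E[f (Xᵗ) - lam | X⁰ = x]` a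
solution of the Poisson equation `h - P h = f - lam` which is bounded uniformly in `ε`
(`poissonSol`, `poissonSol_sub`, `abs_poissonSol_le`). Corrected by `h`, the queue length has a
one-step drift which no longer depends on the modulating state: `V (q, x) = q + h x` has drift
`-ε + u`, where `u` is the mean unused service, which vanishes for `q ≥ Smax`
(`integral_queueKernel_lyapunov`).

*Stability.* Since the increments are bounded, `exp (θ V)` satisfies a geometric drift condition for
small `θ > 0` (`exists_isGeometricLyapunov`). Its sublevel sets are finite, and on a finite set an
irreducible aperiodic chain reaches any given state with positive probability at every large time
(`eventually_pow_singleton_pos`). Harris' theorem (`IsMarkovOpOn.exists_tendsto_pow`), proved by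
running two independent copies of the chain, and tightness then give a stationary distribution to
which the chain converges and which has exponential moments (`exists_stationary`). Positive
recurrence follows from Kac's inequality (`measure_singleton_mul_lintegral_returnTime_le`).

*Heavy traffic.* In steady state `V` and `V ^ 2` have zero mean drift. The first identity says that
the mean unused service is `ε`. In the second one the product of the next queue length with the
unused service is zero, and what remains is
`2 ε E[q] = σs2 + E[h (X¹) ^ 2 - (P h (X⁰)) ^ 2] + O(ε)`, with an error uniform in the modulating
chain (`abs_integral_queue_sub_le`). The modulating chain is stationary there, because its
stationary distribution is unique, so the middle term is the asymptotic variance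
`γ 0 + 2 ∑ γ t` of the arrivals at load `ε` (`integral_condVar_poissonSol`). The uniform geometric
bound on the correlations lets `ε → 0` term by term.
-/

open MeasureTheory ProbabilityTheory Filter Topology
open scoped ENNReal

namespace MarkovQueue

/-! ### Finite-dimensional laws of a Markov chain -/

lemma invariant_pow {E : Type*} [MeasurableSpace E] {K : Kernel E E} {m : Measure E}
    (hm : K.Invariant m) (n : ℕ) : (K ^ n) ∘ₘ m = m := by
  induction n with
  | zero => exact Measure.id_comp
  | succ n ih =>
    rw [pow_succ]
    change ((K ^ n) ∘ₖ K) ∘ₘ m = m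
    rw [← Measure.comp_assoc]
    exact (congrArg (fun m' => (K ^ n) ∘ₘ m') hm.def).trans ih

section Laws

variable {E : Type*} [MeasurableSpace E] (K : Kernel E E) [IsMarkovKernel K]
  (ν₀ : Measure E)

lemma map_zero_chainLaw : (chainLaw K ν₀).map (fun ω => ω 0) = ν₀ := by
  unfold chainLaw Kernel.trajMeasure
  rw [Measure.map_comp _ _ (by fun_prop)]
  have h0 := Kernel.traj_map_frestrictLe (X := fun _ => E)
    (κ := fun n => K.comap (fun h : (i : Finset.Iic n) → E => h ⟨n, Finset.mem_Iic.2 le_rfl⟩)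
      (measurable_pi_apply _)) 0 0
  let e : ((i : Finset.Iic 0) → E) → E := fun h => h ⟨0, Finset.mem_Iic.2 le_rfl⟩
  have he : Measurable e := measurable_pi_apply _
  have h1 : (Kernel.traj (X := fun _ => E)
    (fun n => K.comap (fun h : (i : Finset.Iic n) → E => h ⟨n, Finset.mem_Iic.2 le_rfl⟩)
      (measurable_pi_apply _)) 0).map (fun ω => ω 0) = Kernel.deterministic e he := by
    have : (fun ω : ℕ → E => ω 0) = e ∘ Preorder.frestrictLe 0 := rfl
    rw [this, Kernel.map_comp_right _ (Preorder.measurable_frestrictLe 0) he, h0,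
      Kernel.partialTraj_zero, Kernel.deterministic_map _ he]
    rfl
  rw [h1, Measure.deterministic_comp_eq_map, Measure.map_map (by fun_prop) (by fun_prop)]
  exact Measure.map_id

variable [IsProbabilityMeasure ν₀]

/-- The Markov property, in integrated form. -/
lemma lintegral_chainLaw_succ (n : ℕ)
    {F : ((i : Finset.Iic n) → E) × E → ℝ≥0∞} (hF : Measurable F) :
    ∫⁻ ω, F (fun i => ω i, ω (n + 1)) ∂(chainLaw K ν₀) =
      ∫⁻ ω, ∫⁻ y, F (fun i => ω i, y) ∂(K (ω n)) ∂(chainLaw K ν₀) := by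
  have key := Kernel.map_frestrictLe_trajMeasure_compProd_eq_map_trajMeasure
    (X := fun _ => E) (μ₀ := ν₀)
    (κ := fun n => K.comap (fun h : (i : Finset.Iic n) → E => h ⟨n, Finset.mem_Iic.2 le_rfl⟩)
      (measurable_pi_apply _)) (a := n)
  have h := congrArg (fun m => ∫⁻ p, F p ∂m) key
  rw [Measure.lintegral_compProd hF, lintegral_map hF.lintegral_kernel_prod_right' (by fun_prop),
    lintegral_map hF (by fun_prop)] at h
  exact h.symm

instance isMarkovKernel_pow (n : ℕ) : IsMarkovKernel (K ^ n) := by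
  induction n with
  | zero => exact inferInstanceAs (IsMarkovKernel Kernel.id)
  | succ n ih => rw [pow_succ']; exact inferInstanceAs (IsMarkovKernel (K ∘ₖ (K ^ n)))

/-- The joint law of the states at times `0` and `n`. -/
lemma map_zero_nth_chainLaw (n : ℕ) :
    (chainLaw K ν₀).map (fun ω => (ω 0, ω n)) = ν₀ ⊗ₘ (K ^ n) := by
  induction n with
  | zero =>
    refine Measure.ext_of_lintegral _ fun F hF => ?_
    rw [lintegral_map hF (by fun_prop), Measure.lintegral_compProd hF]
    change _ = ∫⁻ a, ∫⁻ b, F (a, b) ∂(Kernel.id a) ∂ν₀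
    conv_rhs => rw [← map_zero_chainLaw K ν₀]
    have h0 : ∀ a, ∫⁻ b, F (a, b) ∂(Kernel.id a) = F (a, a) := fun a => by
      rw [Kernel.id_apply]
      exact lintegral_dirac' a (hF.comp measurable_prodMk_left)
    simp_rw [h0]
    rw [lintegral_map (by fun_prop) (by fun_prop)]
  | succ n ih =>
    refine Measure.ext_of_lintegral _ fun F hF => ?_
    rw [lintegral_map hF (by fun_prop), Measure.lintegral_compProd hF]
    have h := lintegral_chainLaw_succ K ν₀ n
      (F := fun p => F (p.1 ⟨0, by simp⟩, p.2)) (by fun_prop)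
    simp only at h
    rw [h]
    have hG : Measurable fun p : E × E => ∫⁻ y, F (p.1, y) ∂(K p.2) := by
      have : Measurable fun p : (E × E) × E => F (p.1.1, p.2) := by fun_prop
      exact this.lintegral_kernel_prod_right' (κ := K.comap Prod.snd measurable_snd)
    have h2 := lintegral_map (μ := chainLaw K ν₀) hG
      (show Measurable fun ω : ℕ → E => (ω 0, ω n) by fun_prop)
    rw [← h2, ih, Measure.lintegral_compProd hG]
    refine lintegral_congr fun a => ?_
    rw [pow_succ']
    exact (Kernel.lintegral_comp _ _ _ (hF.comp measurable_prodMk_left)).symm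

lemma map_nth_chainLaw (n : ℕ) :
    (chainLaw K ν₀).map (fun ω => ω n) = (K ^ n) ∘ₘ ν₀ := by
  rw [← Measure.snd_compProd, ← map_zero_nth_chainLaw, Measure.snd,
    Measure.map_map measurable_snd (by fun_prop)]
  rfl

lemma stepProb_eq_pow [MeasurableSingletonClass E] (n : ℕ) (z w : E) :
    stepProb K n z w = (K ^ n) z {w} := by
  have h := map_nth_chainLaw K (Measure.dirac z) n
  rw [Measure.dirac_bind (Kernel.measurable _)] at h
  rw [← h, Measure.map_apply (by fun_prop) (measurableSet_singleton w)]
  rfl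

end Laws

/-! ### Return times and Kac's inequality -/

open Classical in
/-- The tail sum formula for the return time. It is an equality, but the upper bound suffices. -/
lemma returnTime_le_tsum {E : Type*} (z : E) (ω : ℕ → E) :
    returnTime z ω ≤ ∑' n : ℕ, (if ∀ k ∈ Finset.Icc 1 n, ω k ≠ z then 1 else 0 : ℝ≥0∞) := by
  by_cases h : ∃ n, 1 ≤ n ∧ ω n = z
  · have hN := Nat.find_spec h
    set N := Nat.find h with hNdef
    calc returnTime z ω ≤ (N : ℝ≥0∞) := iInf₂_le N hN
      _ = ∑ n ∈ Finset.range N, (if ∀ k ∈ Finset.Icc 1 n, ω k ≠ z then 1 else 0 : ℝ≥0∞) := by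
          rw [Finset.sum_congr rfl (g := fun _ => (1 : ℝ≥0∞))]
          · simp
          · intro n hn
            refine if_pos fun k hk hkz => ?_
            rw [Finset.mem_Icc] at hk
            exact Nat.find_min h (m := k) (by rw [Finset.mem_range] at hn; omega) ⟨hk.1, hkz⟩
      _ ≤ _ := ENNReal.sum_le_tsum _
  · push Not at h
    have : ∀ n, (if ∀ k ∈ Finset.Icc 1 n, ω k ≠ z then 1 else 0 : ℝ≥0∞) = 1 := fun n =>
      if_pos fun k hk => h k (Finset.mem_Icc.1 hk).1
    simp only [this, ENNReal.tsum_const_eq_top_of_ne_zero one_ne_zero, le_top]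

section Kac

variable {E : Type*} [MeasurableSpace E] [Countable E] [MeasurableSingletonClass E]
  (K : Kernel E E)

open Classical in
/-- The transition operator of the chain killed when it enters `z`. -/
noncomputable def tabooOp (z : E) (g : E → ℝ≥0∞) (y : E) : ℝ≥0∞ :=
  ∫⁻ w, (if w = z then 0 else g w) ∂(K y)

open Classical in
/-- The iterates of `tabooOp K z` compute expectations on the event that the chain avoids `z` at
the times `1, …, n`. -/
lemma lintegral_avoid_chainLaw [IsMarkovKernel K] (ν₀ : Measure E) [IsProbabilityMeasure ν₀]
    (z : E) (n : ℕ) (g : E → ℝ≥0∞) :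
    ∫⁻ ω, (if ∀ k ∈ Finset.Icc 1 n, ω k ≠ z then g (ω n) else 0) ∂(chainLaw K ν₀) =
      ∫⁻ y, (tabooOp K z)^[n] g y ∂ν₀ := by
  induction n generalizing g with
  | zero =>
    simp only [Finset.Icc_eq_empty_of_lt one_pos, Finset.notMem_empty, false_imp_iff,
      implies_true, if_true, Function.iterate_zero, id]
    conv_rhs => rw [← map_zero_chainLaw K ν₀]
    rw [lintegral_map Measurable.of_discrete (by fun_prop)]
  | succ n ih =>
    rw [Function.iterate_succ_apply, ← ih]
    let F : ((i : Finset.Iic n) → E) × E → ℝ≥0∞ := fun p =>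
      if ∀ k : Finset.Iic n, 1 ≤ k.1 → p.1 k ≠ z then (if p.2 = z then 0 else g p.2) else 0
    have hF : Measurable F := by
      refine Measurable.ite ?_ ?_ measurable_const
      · have : {p : ((i : Finset.Iic n) → E) × E | ∀ k : Finset.Iic n, 1 ≤ k.1 → p.1 k ≠ z} =
            ⋂ k : Finset.Iic n, ⋂ _ : 1 ≤ k.1, (fun p => p.1 k) ⁻¹' {z}ᶜ := by
          ext; simp
        rw [this]
        refine MeasurableSet.iInter fun k => MeasurableSet.iInter fun _ => ?_
        exact (show Measurable fun p : ((i : Finset.Iic n) → E) × E => p.1 k by fun_prop)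
          (measurableSet_singleton z).compl
      · exact (Measurable.of_discrete (f := fun w => if w = z then 0 else g w)).comp
          measurable_snd
    have h := lintegral_chainLaw_succ K ν₀ n hF
    have hiff : ∀ ω : ℕ → E, (∀ k : Finset.Iic n, 1 ≤ k.1 → ω k ≠ z) ↔
        ∀ k ∈ Finset.Icc 1 n, ω k ≠ z := fun ω =>
      ⟨fun h k hk => h ⟨k, Finset.mem_Iic.2 (Finset.mem_Icc.1 hk).2⟩ (Finset.mem_Icc.1 hk).1,
        fun h k hk => h k (Finset.mem_Icc.2 ⟨hk, Finset.mem_Iic.1 k.2⟩)⟩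
    calc _ = ∫⁻ ω, F (fun i => ω i, ω (n + 1)) ∂(chainLaw K ν₀) := by
          refine lintegral_congr fun ω => ?_
          simp only [F, hiff]
          have : (∀ k ∈ Finset.Icc 1 (n + 1), ω k ≠ z) ↔
              (∀ k ∈ Finset.Icc 1 n, ω k ≠ z) ∧ ω (n + 1) ≠ z := by
            rw [← Finset.insert_Icc_right_eq_Icc_add_one (by omega)]
            simp [and_comm]
          simp only [this]
          split_ifs <;> simp_all
      _ = _ := h
      _ = _ := by
          refine lintegral_congr fun ω => ?_
          simp only [F, hiff, tabooOp]
          split_ifs <;> simp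

/-- Each step of the taboo iteration started from `1` loses exactly the `Ξ`-mass which sits
at `z`. -/
lemma measure_singleton_mul_sum_tabooOp_le {Ξ : Measure E} [IsProbabilityMeasure Ξ]
    (hΞ : K.Invariant Ξ) (z : E) (n : ℕ) :
    ∫⁻ y, (tabooOp K z)^[n] 1 y ∂Ξ + Ξ {z} * ∑ k ∈ Finset.range n, (tabooOp K z)^[k] 1 z = 1 := by
  classical
  induction n with
  | zero => simp
  | succ n ih =>
    rw [← ih, Finset.sum_range_succ, mul_add, add_comm (Ξ {z} * _), ← add_assoc]
    congr 1
    rw [Function.iterate_succ_apply']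
    set v := (tabooOp K z)^[n] 1
    have h1 : ∫⁻ y, tabooOp K z v y ∂Ξ = ∫⁻ w, (if w = z then 0 else v w) ∂Ξ := by
      conv_rhs => rw [← hΞ.def]
      rw [Measure.lintegral_bind (Kernel.aemeasurable _) Measurable.of_discrete.aemeasurable]
      rfl
    have h2 : Ξ {z} * v z = ∫⁻ w, (if w = z then v w else 0) ∂Ξ := by
      rw [← lintegral_indicator_one (measurableSet_singleton z), ← lintegral_mul_const _
        Measurable.of_discrete]
      refine lintegral_congr fun w => ?_
      by_cases hw : w = z <;> simp [hw]
    rw [h1, h2, ← lintegral_add_left Measurable.of_discrete]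
    refine lintegral_congr fun w => ?_
    split_ifs <;> simp

/-- **Kac's inequality**: the mean return time to `z` is at most `1 / Ξ {z}`, for every invariant
probability measure `Ξ`. -/
theorem measure_singleton_mul_lintegral_returnTime_le [IsMarkovKernel K] {Ξ : Measure E}
    [IsProbabilityMeasure Ξ] (hΞ : K.Invariant Ξ) (z : E) :
    Ξ {z} * ∫⁻ ω, returnTime z ω ∂(chainLaw K (Measure.dirac z)) ≤ 1 := by
  classical
  have h : ∫⁻ ω, returnTime z ω ∂(chainLaw K (Measure.dirac z)) ≤
      ∑' n : ℕ, (tabooOp K z)^[n] 1 z := by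
    refine (lintegral_mono (returnTime_le_tsum z)).trans ?_
    rw [lintegral_tsum]
    · refine ENNReal.tsum_le_tsum fun n => ?_
      have := lintegral_avoid_chainLaw K (Measure.dirac z) z n 1
      rw [lintegral_dirac] at this
      exact this.le
    · intro n
      refine (Measurable.ite ?_ measurable_const measurable_const).aemeasurable
      have : {ω : ℕ → E | ∀ k ∈ Finset.Icc 1 n, ω k ≠ z} =
          ⋂ k ∈ Finset.Icc 1 n, (fun ω => ω k) ⁻¹' {z}ᶜ := by
        ext; simp
      rw [this]
      refine Finset.measurableSet_biInter _ fun k _ => ?_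
      exact measurable_pi_apply k (measurableSet_singleton z).compl
  refine (mul_le_mul_right h _).trans ?_
  rw [ENNReal.tsum_eq_iSup_nat, ENNReal.mul_iSup]
  exact iSup_le fun n => le_of_le_of_eq le_add_self
    (measure_singleton_mul_sum_tabooOp_le K hΞ z n)

end Kac

/-! ### Harris' theorem for Markov operators -/

section Harris

variable {E : Type*}

/-- A linear operator on real functions which acts as a Markov operator on the functions on `S`:
on `S` it is monotone and preserves constants, and the values on `S` of `T φ` depend only on the
values of `φ` on `S`. -/
structure IsMarkovOpOn (T : (E → ℝ) →ₗ[ℝ] (E → ℝ)) (S : Set E) : Prop where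
  mono : ∀ φ ψ : E → ℝ, (∀ z ∈ S, φ z ≤ ψ z) → ∀ z ∈ S, T φ z ≤ T ψ z
  one : ∀ z ∈ S, T 1 z = 1

namespace IsMarkovOpOn

variable {T : (E → ℝ) →ₗ[ℝ] (E → ℝ)} {S : Set E}

lemma pow (hT : IsMarkovOpOn T S) (n : ℕ) : IsMarkovOpOn (T ^ n) S := by
  induction n with
  | zero => exact ⟨fun φ ψ h z hz => h z hz, fun z _ => rfl⟩
  | succ n ih =>
    refine ⟨fun φ ψ h z hz => ?_, fun z hz => ?_⟩
    · simp only [pow_succ', Module.End.mul_apply]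
      exact hT.mono _ _ (ih.mono φ ψ h) z hz
    · simp only [pow_succ', Module.End.mul_apply]
      refine le_antisymm ?_ ?_
      · exact (hT.mono _ 1 (fun w hw => (ih.one w hw).le) z hz).trans (hT.one z hz).le
      · exact (hT.one z hz).ge.trans (hT.mono 1 _ (fun w hw => (ih.one w hw).ge) z hz)

lemma affine (hT : IsMarkovOpOn T S) (p q r : ℝ) (f g : E → ℝ) {z : E} (hz : z ∈ S) :
    T (fun v => p + q * f v + r * g v) z = p + q * T f z + r * T g z := by
  have : (fun v => p + q * f v + r * g v) = p • (1 : E → ℝ) + q • f + r • g := by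
    ext v; simp
  rw [this, map_add, map_add, map_smul, map_smul, map_smul]
  simp [hT.one z hz]

lemma nonneg (hT : IsMarkovOpOn T S) {f : E → ℝ} (hf : ∀ z ∈ S, 0 ≤ f z) {z : E} (hz : z ∈ S) :
    0 ≤ T f z := by
  simpa using hT.mono 0 f hf z hz

/-- A geometric drift condition passes to all iterates, with uniform constants. -/
lemma pow_drift (hT : IsMarkovOpOn T S) {L : E → ℝ} {γ b : ℝ} (hγ0 : 0 ≤ γ) (hγ1 : γ < 1)
    (hb : 0 ≤ b) (hL : ∀ z ∈ S, T L z ≤ γ * L z + b) (n : ℕ) :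
    ∀ z ∈ S, (T ^ n) L z ≤ γ ^ n * L z + b / (1 - γ) := by
  have h1 : 0 < 1 - γ := by linarith
  have key : ∀ z ∈ S, (T ^ n) L z ≤ γ ^ n * L z + b * (1 - γ ^ n) / (1 - γ) := by
    induction n with
    | zero => intro z _; simp
    | succ n ih =>
      intro z hz
      rw [pow_succ', Module.End.mul_apply]
      have h := hT.mono _ (fun v => b * (1 - γ ^ n) / (1 - γ) + γ ^ n * L v + 0 * L v)
        (fun w hw => (ih w hw).trans (by linarith)) z hz
      rw [hT.affine _ _ _ _ _ hz] at h
      have h2 := mul_le_mul_of_nonneg_left (hL z hz) (pow_nonneg hγ0 n)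
      have h3 : b * (1 - γ ^ (n + 1)) / (1 - γ) = b * (1 - γ ^ n) / (1 - γ) + γ ^ n * b := by
        field_simp
        ring
      rw [h3, pow_succ]
      linarith
  intro z hz
  refine (key z hz).trans (add_le_add_right ?_ _)
  gcongr
  exact mul_le_of_le_one_right hb (by linarith [pow_nonneg hγ0 n])

open Classical in
/-- One step of Harris' theorem: two independent copies of the chain are at the same point `w₀`
with probability at least `a ^ 2` when both start from the sublevel set `{L ≤ R}`, and otherwise
the drift condition contracts the weight `2 + β L x + β L y`. -/
lemma exists_contraction (hT : IsMarkovOpOn T S) {L : E → ℝ} {γ b : ℝ} (hγ0 : 0 ≤ γ)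
    (hγ1 : γ < 1) (hb : 0 ≤ b) (hL0 : ∀ z ∈ S, 0 ≤ L z) (hL : ∀ z ∈ S, T L z ≤ γ * L z + b)
    {w₀ : E} {a R : ℝ} (ha0 : 0 < a) (hR0 : 0 < R) (hR : 4 * b ≤ (1 - γ) * R)
    (hmin : ∀ z ∈ S, L z ≤ R → a ≤ T (Pi.single w₀ 1) z) :
    ∃ β κ : ℝ, 0 < β ∧ 0 ≤ κ ∧ κ < 1 ∧ ∀ (φ : E → ℝ) (c : ℝ), 0 ≤ c →
      (∀ x ∈ S, ∀ y ∈ S, φ x - φ y ≤ c * (2 + β * L x + β * L y)) →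
      ∀ x ∈ S, ∀ y ∈ S, T φ x - T φ y ≤ c * κ * (2 + β * L x + β * L y) := by
  obtain ⟨β, hβ0, hβb⟩ : ∃ β : ℝ, 0 < β ∧ 2 * β * b ≤ a ^ 2 := by
    refine ⟨a ^ 2 / (2 * (b + 1)), by positivity, ?_⟩
    have : 2 * (a ^ 2 / (2 * (b + 1))) * b = a ^ 2 * (b / (b + 1)) := by field_simp
    rw [this]
    exact mul_le_of_le_one_right (by positivity) ((div_le_one (by linarith)).2 (by linarith))
  set γ₀ := (1 + γ) / 2 with hγ₀
  set κ₁ := (2 + β * γ₀ * R) / (2 + β * R) with hκ₁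
  have hden : 0 < 2 + β * R := by positivity
  have hκ₁0 : 0 ≤ κ₁ := by have : 0 ≤ γ₀ := by linarith
                           positivity
  have hκ₁1 : κ₁ < 1 := by
    rw [hκ₁, div_lt_one hden]
    have : β * R * γ₀ < β * R := mul_lt_of_lt_one_right (by positivity) (by linarith)
    nlinarith
  set κ := max κ₁ (max (1 - a ^ 2 / 2) γ) with hκ
  have hκ0 : 0 ≤ κ := hκ₁0.trans (le_max_left _ _)
  refine ⟨β, κ, hβ0, hκ0, max_lt hκ₁1 (max_lt (by have := pow_pos ha0 2; linarith) hγ1), ?_⟩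
  intro φ c hc hφ x hx y hy
  have hind : ∀ z ∈ S, (0 : ℝ) ≤ (Pi.single w₀ 1 : E → ℝ) z := fun z _ => by
    rw [Pi.single_apply]; split_ifs <;> norm_num
  set px := T (Pi.single w₀ 1) x
  set py := T (Pi.single w₀ 1) y
  have hpx : 0 ≤ px := hT.nonneg hind hx
  have hpy : 0 ≤ py := hT.nonneg hind hy
  -- the difference `φ u - φ v` vanishes when both copies are at `w₀`
  have hpair : ∀ u ∈ S, ∀ v ∈ S, φ u - φ v ≤ c * (2 + β * L u + β * L v)
      - 2 * c * (Pi.single w₀ 1 : E → ℝ) u * (Pi.single w₀ 1 : E → ℝ) v := by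
    intro u hu v hv
    rw [Pi.single_apply, Pi.single_apply]
    by_cases h : u = w₀ ∧ v = w₀
    · rw [if_pos h.1, if_pos h.2, h.1, h.2]
      have := hL0 w₀ (h.1 ▸ hu)
      have : 0 ≤ c * (β * L w₀) := by positivity
      linarith
    · have : (if u = w₀ then (1 : ℝ) else 0) * (if v = w₀ then 1 else 0) = 0 := by
        rcases not_and_or.1 h with h | h <;> simp [h]
      rw [mul_assoc, this]
      simpa using hφ u hu v hv
  -- average over `v` first
  have h1 : ∀ u ∈ S, φ u - T φ y ≤ c * (2 + β * L u + β * T L y)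
      - 2 * c * (Pi.single w₀ 1 : E → ℝ) u * py := by
    intro u hu
    have h := hT.mono (fun v => φ u + (-1) * φ v + 0 * φ v)
      (fun v => c * (2 + β * L u) + (c * β) * L v
        + (-(2 * c * (Pi.single w₀ 1 : E → ℝ) u)) * (Pi.single w₀ 1 : E → ℝ) v)
      (fun v hv => by linarith [hpair u hu v hv]) y hy
    rw [hT.affine _ _ _ _ _ hy, hT.affine _ _ _ _ _ hy] at h
    linarith
  have h2 : T φ x - T φ y ≤ c * (2 + β * T L x + β * T L y) - 2 * c * px * py := by
    have h := hT.mono (fun u => -T φ y + 1 * φ u + 0 * φ u)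
      (fun u => c * (2 + β * T L y) + (c * β) * L u
        + (-(2 * c * py)) * (Pi.single w₀ 1 : E → ℝ) u)
      (fun u hu => by linarith [h1 u hu]) x hx
    rw [hT.affine _ _ _ _ _ hx, hT.affine _ _ _ _ _ hx] at h
    linarith
  set l := L x + L y with hl
  have hl0 : 0 ≤ l := add_nonneg (hL0 x hx) (hL0 y hy)
  have h3 : β * T L x + β * T L y ≤ β * γ * l + 2 * β * b := by
    have := mul_le_mul_of_nonneg_left (add_le_add (hL x hx) (hL y hy)) hβ0.le
    linarith
  have h4 : T φ x - T φ y ≤ c * (2 + β * γ * l + 2 * β * b - 2 * (px * py)) := by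
    have := mul_le_mul_of_nonneg_left h3 hc
    linarith
  have h5 : 2 + β * γ * l + 2 * β * b - 2 * (px * py) ≤ κ * (2 + β * l) := by
    -- below level `R` the chance `a ^ 2` of meeting contracts, above it the drift does
    rcases le_total l R with hlR | hlR
    · have hax := hmin x hx (by linarith [hL0 y hy])
      have hay := hmin y hy (by linarith [hL0 x hx])
      have : a * a ≤ px * py := mul_le_mul hax hay ha0.le hpx
      have h6 : 1 - a ^ 2 / 2 ≤ κ := (le_max_left _ _).trans (le_max_right _ _)
      have h7 : γ * (β * l) ≤ κ * (β * l) :=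
        mul_le_mul_of_nonneg_right ((le_max_right _ _).trans (le_max_right _ _)) (by positivity)
      nlinarith
    · have h6 : κ₁ * (2 + β * l) ≤ κ * (2 + β * l) :=
        mul_le_mul_of_nonneg_right (le_max_left _ _) (by positivity)
      have h7 : 2 + β * γ₀ * l ≤ κ₁ * (2 + β * l) := by
        rw [hκ₁, div_mul_eq_mul_div, le_div_iff₀ hden]
        have : 0 ≤ β * (1 - γ₀) * (l - R) :=
          mul_nonneg (mul_nonneg hβ0.le (by linarith)) (by linarith)
        nlinarith
      have h8 : 4 * b ≤ (1 - γ) * l :=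
        hR.trans (mul_le_mul_of_nonneg_left hlR (by linarith))
      have h9 := mul_le_mul_of_nonneg_left h8 hβ0.le
      have h10 : β * γ₀ * l = β * l / 2 + β * γ * l / 2 := by rw [hγ₀]; ring
      have h11 : 0 ≤ px * py := mul_nonneg hpx hpy
      linarith
  calc T φ x - T φ y ≤ c * (κ * (2 + β * l)) := h4.trans (mul_le_mul_of_nonneg_left h5 hc)
    _ = _ := by rw [hl]; ring

open Classical in
/-- **Harris' theorem**: a Markov operator with a geometric drift condition, one of whose iterates
charges a point uniformly on a sublevel set, forgets its starting point. -/
theorem exists_tendsto_pow (hT : IsMarkovOpOn T S) (hS : S.Nonempty) {L : E → ℝ} {γ b : ℝ}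
    (hγ0 : 0 ≤ γ) (hγ1 : γ < 1) (hb : 0 ≤ b) (hL0 : ∀ z ∈ S, 0 ≤ L z)
    (hL : ∀ z ∈ S, T L z ≤ γ * L z + b)
    (hmin : ∀ R : ℝ, ∃ N : ℕ, 1 ≤ N ∧ ∃ w₀ : E, ∃ a : ℝ, 0 < a ∧
      ∀ z ∈ S, L z ≤ R → a ≤ (T ^ N) (Pi.single w₀ 1) z)
    {φ : E → ℝ} (hφ : ∀ z ∈ S, |φ z| ≤ 1) :
    ∃ l : ℝ, ∀ z ∈ S, Tendsto (fun n => (T ^ n) φ z) atTop (𝓝 l) := by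
  have h1γ : 0 < 1 - γ := by linarith
  set b' := b / (1 - γ) with hb'
  have hb'0 : 0 ≤ b' := by positivity
  -- `b'` bounds the drift constants of all iterates, so the level can be fixed before `N`
  obtain ⟨N, hN, w₀, a, ha, hmin⟩ := hmin (4 * b' / (1 - γ) + 1)
  have hdrift := hT.pow_drift hγ0 hγ1 hb hL
  obtain ⟨β, κ, hβ, hκ0, hκ1, hcon⟩ := (hT.pow N).exists_contraction (L := L) (b := b')
    hγ0 hγ1 hb'0 hL0
    (fun z hz => (hdrift N z hz).trans (by
      have := mul_le_mul_of_nonneg_right (pow_le_of_le_one hγ0 hγ1.le (by omega : N ≠ 0))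
        (hL0 z hz)
      linarith))
    ha (by positivity) (by rw [mul_add, mul_div_cancel₀ _ h1γ.ne']; linarith) hmin
  -- the oscillation of the iterates decays geometrically along multiples of `N`
  have hosc : ∀ (k : ℕ) (ψ : E → ℝ), (∀ z ∈ S, |ψ z| ≤ 1) → ∀ x ∈ S, ∀ y ∈ S,
      (T ^ (N * k)) ψ x - (T ^ (N * k)) ψ y ≤ κ ^ k * (2 + β * L x + β * L y) := by
    intro k ψ hψ
    induction k with
    | zero =>
      intro x hx y hy
      have h1 := abs_le.1 (hψ x hx)
      have h2 := abs_le.1 (hψ y hy)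
      have h3 := mul_nonneg hβ.le (hL0 x hx)
      have h4 := mul_nonneg hβ.le (hL0 y hy)
      simp only [mul_zero, pow_zero, one_mul, Module.End.one_apply]
      linarith
    | succ k ih =>
      have := hcon _ _ (pow_nonneg hκ0 k) ih
      rw [mul_add, mul_one, add_comm, pow_add, pow_succ]
      exact this
  have hbdd : ∀ (r : ℕ), ∀ z ∈ S, |(T ^ r) φ z| ≤ 1 := fun r z hz => by
    have h1 := (hT.pow r).one z hz
    refine abs_le.2 ⟨?_, ?_⟩
    · have := (hT.pow r).mono (-1) φ (fun w hw => (abs_le.1 (hφ w hw)).1) z hz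
      rw [map_neg, Pi.neg_apply, h1] at this
      exact this
    · exact ((hT.pow r).mono φ 1 (fun w hw => (abs_le.1 (hφ w hw)).2) z hz).trans h1.le
  have hosc' : ∀ (k n : ℕ), N * k ≤ n → ∀ x ∈ S, ∀ y ∈ S,
      (T ^ n) φ x - (T ^ n) φ y ≤ κ ^ k * (2 + β * L x + β * L y) := by
    intro k n hn
    obtain ⟨r, rfl⟩ := Nat.exists_eq_add_of_le hn
    have := hosc k _ (hbdd r)
    rwa [pow_add]
  have hcauchy : ∀ (k n m : ℕ), N * k ≤ n → ∀ x ∈ S,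
      |(T ^ (m + n)) φ x - (T ^ n) φ x| ≤ κ ^ k * (2 + 2 * β * L x + β * b') := by
    intro k n m hn x hx
    have hTm := hT.pow m
    have hosc := hosc' k n hn
    rw [pow_add, Module.End.mul_apply]
    set ψ := (T ^ n) φ
    have hLm : (T ^ m) L x ≤ L x + b' := (hdrift m x hx).trans (by
      have := mul_le_mul_of_nonneg_right (pow_le_one₀ (n := m) hγ0 hγ1.le) (hL0 x hx)
      linarith)
    have hκk := pow_nonneg hκ0 k
    have hLm' := mul_le_mul_of_nonneg_left hLm (mul_nonneg hκk hβ.le)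
    refine abs_le.2 ⟨?_, ?_⟩
    · have h := hTm.mono (fun u => ψ x + (-1) * ψ u + 0 * ψ u)
        (fun u => κ ^ k * (2 + β * L x) + (κ ^ k * β) * L u + 0 * ψ u)
        (fun u hu => by linarith [hosc x hx u hu]) x hx
      rw [hTm.affine _ _ _ _ _ hx, hTm.affine _ _ _ _ _ hx] at h
      linarith
    · have h := hTm.mono (fun u => -ψ x + 1 * ψ u + 0 * ψ u)
        (fun u => κ ^ k * (2 + β * L x) + (κ ^ k * β) * L u + 0 * ψ u)
        (fun u hu => by linarith [hosc u hu x hx]) x hx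
      rw [hTm.affine _ _ _ _ _ hx, hTm.affine _ _ _ _ _ hx] at h
      linarith
  have hsmall : ∀ (M : ℝ) (ε : ℝ), 0 < ε → ∃ k : ℕ, κ ^ k * M < ε := fun M ε hε => by
    have h := (tendsto_pow_atTop_nhds_zero_of_lt_one hκ0 hκ1).mul_const M
    rw [zero_mul] at h
    exact (h.eventually (gt_mem_nhds hε)).exists
  obtain ⟨x₀, hx₀⟩ := hS
  have hC : CauchySeq fun n => (T ^ n) φ x₀ := by
    refine Metric.cauchySeq_iff'.2 fun ε hε => ?_
    obtain ⟨k, hk⟩ := hsmall (2 + 2 * β * L x₀ + β * b') ε hε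
    refine ⟨N * k, fun n hn => ?_⟩
    obtain ⟨m, rfl⟩ := Nat.exists_eq_add_of_le' hn
    exact (hcauchy k _ m le_rfl x₀ hx₀).trans_lt hk
  obtain ⟨l, hl⟩ := cauchySeq_tendsto_of_complete hC
  refine ⟨l, fun z hz => ?_⟩
  have hdiff : Tendsto (fun n => (T ^ n) φ z - (T ^ n) φ x₀) atTop (𝓝 0) := by
    refine Metric.tendsto_atTop.2 fun ε hε => ?_
    obtain ⟨k, hk⟩ := hsmall (2 + β * L z + β * L x₀) ε hε
    refine ⟨N * k, fun n hn => ?_⟩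
    rw [Real.dist_eq, sub_zero]
    refine lt_of_le_of_lt (abs_le.2 ⟨?_, hosc' k n hn z hz x₀ hx₀⟩) hk
    have := hosc' k n hn x₀ hx₀ z hz
    linarith
  simpa using hdiff.add hl

end IsMarkovOpOn

end Harris

/-! ### Aperiodicity and eventual positivity -/

section Aperiodic

variable {E : Type*} [MeasurableSpace E] [MeasurableSingletonClass E]
  {K : Kernel E E}

lemma pow_add_singleton_pos {m n : ℕ} {x y z : E} (h1 : 0 < (K ^ m) x {y})
    (h2 : 0 < (K ^ n) y {z}) : 0 < (K ^ (m + n)) x {z} := by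
  rw [Kernel.pow_add_apply_eq_lintegral _ _ _ _ (measurableSet_singleton z)]
  refine (ENNReal.mul_pos h2.ne' h1.ne').trans_le ?_
  rw [← lintegral_singleton (fun b => (K ^ n) b {z}) y]
  exact setLIntegral_le_lintegral _ _

variable [IsMarkovKernel K]

/-- In an irreducible aperiodic chain, every `n`-step transition probability is positive for all
large `n`: the set of possible return times is an additive monoid with greatest common
divisor `1`. -/
lemma eventually_pow_singleton_pos {S : Set E} (hirr : IsIrreducibleOn K S)
    (haper : IsAperiodicOn K S) {z w : E} (hz : z ∈ S) (hw : w ∈ S) :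
    ∀ᶠ n in atTop, 0 < (K ^ n) z {w} := by
  obtain ⟨k, hk⟩ := hirr.communicate z hz w hw
  rw [stepProb_eq_pow] at hk
  set s : Set ℕ := {n | 1 ≤ n ∧ 0 < (K ^ n) z {z}}
  have hgcd : Nat.setGcd s = 1 := haper z hz _ fun n hn h => by
    rw [stepProb_eq_pow] at h
    exact Nat.setGcd_dvd_of_mem ⟨hn, h⟩
  have hcl : ∀ n ∈ AddSubmonoid.closure s, 0 < (K ^ n) z {z} := fun n hn => by
    induction hn using AddSubmonoid.closure_induction with
    | mem n hn => exact hn.2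
    | zero =>
      change 0 < (Kernel.id z) {z}
      rw [Kernel.id_apply, Measure.dirac_apply' _ (measurableSet_singleton z)]
      simp
    | add m n _ _ hm hn => exact pow_add_singleton_pos hm hn
  obtain ⟨N, hN⟩ := Nat.exists_mem_closure_of_ge s
  refine eventually_atTop.2 ⟨N + k, fun n hn => ?_⟩
  have := pow_add_singleton_pos (hcl (n - k) (hN _ (by omega) (hgcd ▸ one_dvd _))) hk
  rwa [Nat.sub_add_cancel (by omega)] at this

end Aperiodic

/-! ### The ergodic theorem under a geometric drift condition -/

section Ergodic

lemma integral_comp_measure {α β : Type*} [MeasurableSpace α] [MeasurableSpace β]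
    {κ : Kernel α β} {m : Measure α} {φ : β → ℝ} (hφ : Integrable φ (κ ∘ₘ m)) :
    ∫ y, φ y ∂(κ ∘ₘ m) = ∫ x, ∫ y, φ y ∂(κ x) ∂m := by
  have h := Kernel.integral_comp (a := ()) (κ := Kernel.const Unit m) (η := κ) (f := φ)
  rw [Kernel.comp_const] at h
  exact h hφ

variable {E : Type*} [MeasurableSpace E] [MeasurableSingletonClass E]

lemma integrable_of_abs_le [Countable E] {m : Measure E} [IsFiniteMeasure m] {φ : E → ℝ} {M : ℝ}
    (hφ : ∀ z, |φ z| ≤ M) : Integrable φ m :=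
  Integrable.of_bound Measurable.of_discrete.aestronglyMeasurable M (ae_of_all _ hφ)

/-- The measure `m` is carried by a finite set. -/
def IsFinitelySupported (m : Measure E) : Prop := ∃ F : Set E, F.Finite ∧ m Fᶜ = 0

lemma IsFinitelySupported.integrable {m : Measure E} [IsFiniteMeasure m]
    (hm : IsFinitelySupported m) (φ : E → ℝ) : Integrable φ m := by
  obtain ⟨F, hF, h⟩ := hm
  have hr : m.restrict F = m := Measure.restrict_eq_self_of_ae_mem h
  have := IntegrableOn.finset (μ := m) (s := hF.toFinset) (f := φ)
  rwa [Set.Finite.coe_toFinset, IntegrableOn, hr] at this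

variable {K : Kernel E E}

lemma IsFinitelySupported.pow (hK : ∀ z, IsFinitelySupported (K z)) (n : ℕ) (z : E) :
    IsFinitelySupported ((K ^ n) z) := by
  induction n with
  | zero =>
    refine ⟨{z}, Set.finite_singleton z, ?_⟩
    change (Kernel.id z) _ = 0
    rw [Kernel.id_apply, Measure.dirac_apply' _ (measurableSet_singleton z).compl]
    simp
  | succ n ih =>
    obtain ⟨F, hF, hF0⟩ := ih
    choose G hG hG0 using hK
    have hfin : (⋃ w ∈ F, G w).Finite := hF.biUnion fun w _ => hG w
    refine ⟨_, hfin, ?_⟩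
    rw [Kernel.pow_succ_apply_eq_lintegral _ _ _ hfin.measurableSet.compl]
    refine (lintegral_congr_ae ?_).trans lintegral_zero
    have : ∀ᵐ w ∂((K ^ n) z), w ∈ F := hF0
    filter_upwards [this] with w hw
    exact measure_mono_null (Set.compl_subset_compl.2 (Set.subset_biUnion_of_mem hw)) (hG0 w)

lemma pow_compl_eq_zero [Countable E] {S : Set E} (hS : ∀ z ∈ S, K z Sᶜ = 0) (n : ℕ) {z : E}
    (hz : z ∈ S) : (K ^ n) z Sᶜ = 0 := by
  have hm : MeasurableSet S := MeasurableSet.of_discrete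
  induction n with
  | zero =>
    change (Kernel.id z) _ = 0
    rw [Kernel.id_apply, Measure.dirac_apply' _ hm.compl]
    simp [hz]
  | succ n ih =>
    rw [Kernel.pow_succ_apply_eq_lintegral _ _ _ hm.compl]
    refine (lintegral_congr_ae ?_).trans lintegral_zero
    have : ∀ᵐ w ∂((K ^ n) z), w ∈ S := ih
    filter_upwards [this] with w hw using hS w hw

variable [IsMarkovKernel K]

/-- The transition operator `φ ↦ (z ↦ ∫ φ dK z)` on all real functions, for a kernel with finitely
supported transition laws. -/
noncomputable def transOp (K : Kernel E E) [IsMarkovKernel K]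
    (hK : ∀ z, IsFinitelySupported (K z)) : (E → ℝ) →ₗ[ℝ] (E → ℝ) where
  toFun φ z := ∫ w, φ w ∂(K z)
  map_add' φ ψ := funext fun z => integral_add ((hK z).integrable φ) ((hK z).integrable ψ)
  map_smul' c φ := funext fun _ => integral_const_mul c φ

lemma transOp_pow_apply (hK : ∀ z, IsFinitelySupported (K z)) (n : ℕ) (φ : E → ℝ) (z : E) :
    (transOp K hK ^ n) φ z = ∫ w, φ w ∂((K ^ n) z) := by
  induction n generalizing z with
  | zero =>
    change φ z = ∫ w, φ w ∂(Kernel.id z)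
    rw [Kernel.id_apply, integral_dirac]
  | succ n ih =>
    rw [pow_succ', Module.End.mul_apply]
    change ∫ w, (transOp K hK ^ n) φ w ∂(K z) = _
    simp_rw [ih]
    have hi := (IsFinitelySupported.pow hK (n + 1) z).integrable φ
    rw [pow_succ] at hi ⊢
    exact (Kernel.integral_comp hi).symm

lemma isMarkovOpOn_transOp (hK : ∀ z, IsFinitelySupported (K z)) {S : Set E}
    (hS : ∀ z ∈ S, K z Sᶜ = 0) : IsMarkovOpOn (transOp K hK) S where
  mono φ ψ h z hz := by
    refine integral_mono_ae ((hK z).integrable φ) ((hK z).integrable ψ) ?_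
    have : ∀ᵐ w ∂(K z), w ∈ S := hS z hz
    filter_upwards [this] with w hw using h w hw
  one z _ := by
    change ∫ _, (1 : ℝ) ∂(K z) = 1
    simp

open Classical in
/-- The minorization condition of Harris' theorem holds on every finite set of states. -/
lemma exists_pow_single_lower_bound (hK : ∀ z, IsFinitelySupported (K z)) {S : Set E}
    (hirr : IsIrreducibleOn K S) (haper : IsAperiodicOn K S) {F : Set E} (hF : F.Finite)
    (hFS : F ⊆ S) :
    ∃ N : ℕ, 1 ≤ N ∧ ∃ w₀ : E, ∃ a : ℝ, 0 < a ∧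
      ∀ z ∈ F, a ≤ (transOp K hK ^ N) (Pi.single w₀ 1) z := by
  obtain ⟨w₀, hw₀⟩ := hirr.nonempty
  have h1 : ∀ᶠ n in atTop, ∀ z ∈ F, 0 < (K ^ n) z {w₀} :=
    (eventually_all_finite hF).2 fun z hz =>
      eventually_pow_singleton_pos hirr haper (hFS hz) hw₀
  obtain ⟨N, hN, hN1⟩ := (h1.and (eventually_ge_atTop 1)).exists
  have h2 : ∀ᶠ a : ℝ in 𝓝[>] 0, ∀ z ∈ F, a ≤ ((K ^ N) z).real {w₀} :=
    (eventually_all_finite hF).2 fun z hz => by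
      have : 0 < ((K ^ N) z).real {w₀} := ENNReal.toReal_pos (hN z hz).ne' (measure_ne_top _ _)
      filter_upwards [Ioo_mem_nhdsGT this] with a ha using ha.2.le
  obtain ⟨a, ha, ha0⟩ := (h2.and self_mem_nhdsWithin).exists
  refine ⟨N, hN1, w₀, a, ha0, fun z hz => (ha z hz).trans_eq ?_⟩
  rw [transOp_pow_apply, ← integral_indicator_one (measurableSet_singleton w₀)]
  refine integral_congr_ae (ae_of_all _ fun w => ?_)
  by_cases hw : w = w₀ <;> simp [hw]

/-- A Lyapunov function with a geometric drift: `L` is nonnegative, its sublevel sets in `S` are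
finite, and `∫ L dK z ≤ γ L z + b` on `S`, with `γ < 1`. -/
structure IsGeometricLyapunov (K : Kernel E E) (S : Set E) (L : E → ℝ) (γ b : ℝ) : Prop where
  nonneg : ∀ z, 0 ≤ L z
  finite_sublevel : ∀ R : ℝ, {z ∈ S | L z ≤ R}.Finite
  rate_nonneg : 0 ≤ γ
  rate_lt_one : γ < 1
  const_nonneg : 0 ≤ b
  drift : ∀ z ∈ S, ∫ w, L w ∂(K z) ≤ γ * L z + b

section

variable {S : Set E} {L : E → ℝ} {γ b : ℝ}

lemma IsGeometricLyapunov.integral_pow_le (hL : IsGeometricLyapunov K S L γ b)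
    (hK : ∀ z, IsFinitelySupported (K z)) (hS : ∀ z ∈ S, K z Sᶜ = 0) (n : ℕ) {z : E}
    (hz : z ∈ S) : ∫ w, L w ∂((K ^ n) z) ≤ L z + b / (1 - γ) := by
  have h := (isMarkovOpOn_transOp hK hS).pow_drift hL.rate_nonneg hL.rate_lt_one hL.const_nonneg
    hL.drift n z hz
  rw [transOp_pow_apply] at h
  have := mul_le_mul_of_nonneg_right (pow_le_one₀ (n := n) hL.rate_nonneg hL.rate_lt_one.le)
    (hL.nonneg z)
  linarith

lemma exists_tendsto_integral_pow (hK : ∀ z, IsFinitelySupported (K z))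
    (hirr : IsIrreducibleOn K S) (haper : IsAperiodicOn K S)
    (hL : IsGeometricLyapunov K S L γ b) {φ : E → ℝ} {M : ℝ} (hφ : ∀ z, |φ z| ≤ M) :
    ∃ l : ℝ, ∀ z ∈ S, Tendsto (fun n : ℕ => ∫ w, φ w ∂((K ^ n) z)) atTop (𝓝 l) := by
  classical
  have hM : 0 ≤ M := by
    obtain ⟨z, _⟩ := hirr.nonempty
    exact (abs_nonneg _).trans (hφ z)
  have hT := isMarkovOpOn_transOp hK hirr.closed
  obtain ⟨l, hl⟩ := hT.exists_tendsto_pow hirr.nonempty hL.rate_nonneg hL.rate_lt_one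
    hL.const_nonneg (fun z _ => hL.nonneg z) hL.drift
    (fun R => by
      obtain ⟨N, hN, w₀, a, ha, h⟩ := exists_pow_single_lower_bound hK hirr haper
        (hL.finite_sublevel R) (fun z hz => hz.1)
      exact ⟨N, hN, w₀, a, ha, fun z hz hzR => h z ⟨hz, hzR⟩⟩)
    (φ := (M + 1)⁻¹ • φ)
    (fun z _ => by
      rw [Pi.smul_apply, smul_eq_mul, abs_mul, abs_of_pos (by positivity : 0 < (M + 1)⁻¹),
        inv_mul_le_one₀ (by positivity)]
      linarith [hφ z])
  refine ⟨(M + 1) * l, fun z hz => ?_⟩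
  have h := (hl z hz).const_mul (M + 1)
  refine h.congr fun n => ?_
  rw [map_smul, Pi.smul_apply, smul_eq_mul, mul_inv_cancel_left₀ (by positivity),
    transOp_pow_apply]

variable [Countable E]

/-- The laws of the chain converge weakly, for the discrete topology, to a probability measure:
they are tight by the drift condition, and Harris' theorem leaves only one possible cluster
point. -/
lemma exists_limit_law (hK : ∀ z, IsFinitelySupported (K z))
    (hirr : IsIrreducibleOn K S) (haper : IsAperiodicOn K S)
    (hL : IsGeometricLyapunov K S L γ b) :
    ∃ Ξ : ProbabilityMeasure E, ∀ (φ : E → ℝ) (M : ℝ), (∀ z, |φ z| ≤ M) → ∀ z ∈ S,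
      Tendsto (fun n : ℕ => ∫ w, φ w ∂((K ^ n) z)) atTop (𝓝 (∫ w, φ w ∂(Ξ : Measure E))) := by
  let _ : TopologicalSpace E := ⊥
  have : DiscreteTopology E := ⟨rfl⟩
  have : BorelSpace E := by
    refine ⟨le_antisymm (fun s _ => ?_) (fun s _ => MeasurableSet.of_discrete)⟩
    exact MeasurableSpace.measurableSet_generateFrom (isOpen_discrete s)
  obtain ⟨z₀, hz₀⟩ := hirr.nonempty
  let m : ℕ → ProbabilityMeasure E := fun n => ⟨(K ^ n) z₀, inferInstance⟩
  set M₀ := L z₀ + b / (1 - γ)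
  have hM₀ : ∀ n, ∫ w, L w ∂((K ^ n) z₀) ≤ M₀ := fun n =>
    hL.integral_pow_le hK hirr.closed n hz₀
  have htight : IsTightMeasureSet
      {((μ : ProbabilityMeasure E) : Measure E) | μ ∈ Set.range m} := by
    rw [isTightMeasureSet_iff_exists_isCompact_measure_compl_le]
    intro ε hε
    obtain ⟨R, hR0, hR⟩ : ∃ R : ℝ, 0 < R ∧ ENNReal.ofReal (M₀ / R) ≤ ε := by
      have h1 : Tendsto (fun R : ℝ => ENNReal.ofReal (M₀ / R)) atTop (𝓝 0) := by
        have := ENNReal.tendsto_ofReal (tendsto_const_nhds (x := M₀).div_atTop tendsto_id)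
        simpa using this
      obtain ⟨R, h2, h3⟩ := ((h1.eventually (ge_mem_nhds hε)).and (eventually_gt_atTop 0)).exists
      exact ⟨R, h3, h2⟩
    refine ⟨{z ∈ S | L z ≤ R}, (hL.finite_sublevel R).isCompact, ?_⟩
    rintro _ ⟨_, ⟨n, rfl⟩, rfl⟩
    change (K ^ n) z₀ _ ≤ ε
    refine le_trans ?_ hR
    have h1 : (K ^ n) z₀ {z ∈ S | L z ≤ R}ᶜ ≤ (K ^ n) z₀ {z | R ≤ L z} := by
      have : {z ∈ S | L z ≤ R}ᶜ ⊆ Sᶜ ∪ {z | R ≤ L z} := fun z hz => by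
        by_cases h : z ∈ S
        · exact Or.inr (le_of_lt (not_le.1 fun h' => hz ⟨h, h'⟩))
        · exact Or.inl h
      refine (measure_mono this).trans ((measure_union_le _ _).trans ?_)
      rw [pow_compl_eq_zero hirr.closed n hz₀, zero_add]
    refine h1.trans ?_
    have h2 := mul_meas_ge_le_integral_of_nonneg (μ := (K ^ n) z₀) (ae_of_all _ hL.nonneg)
      ((IsFinitelySupported.pow hK n z₀).integrable L) R
    rw [← ofReal_measureReal]
    refine ENNReal.ofReal_le_ofReal ?_
    rw [le_div_iff₀ hR0, mul_comm]
    exact h2.trans (hM₀ n)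
  obtain ⟨Ξ, -, hΞ⟩ := (isCompact_closure_of_isTightMeasureSet htight).exists_mapClusterPt
    (f := atTop) (u := m) (by
      rw [le_principal_iff]
      exact mem_map.2 (univ_mem' fun n => subset_closure ⟨n, rfl⟩))
  refine ⟨Ξ, fun φ M hφ z hz => ?_⟩
  obtain ⟨l, hl⟩ := exists_tendsto_integral_pow hK hirr haper hL hφ
  let φ' : BoundedContinuousFunction E ℝ := BoundedContinuousFunction.mkOfDiscrete φ (M + M)
    fun x y => (dist_le_norm_add_norm _ _).trans (add_le_add (hφ x) (hφ y))
  have hc := hΞ.tendsto_comp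
    (ProbabilityMeasure.continuous_integral_boundedContinuousFunction φ').continuousAt
  have hlim : Tendsto ((fun μ : ProbabilityMeasure E => ∫ w, φ' w ∂(μ : Measure E)) ∘ m) atTop
      (𝓝 l) := hl z₀ hz₀
  have : ∫ w, φ w ∂(Ξ : Measure E) = l :=
    eq_of_nhds_neBot (hc.neBot.mono (inf_le_inf_left _ hlim))
  rw [this]
  exact hl z hz

/-- **Ergodic theorem**: an irreducible aperiodic chain with a geometric Lyapunov function has a
stationary distribution on `S`, which integrates the Lyapunov function and to which the chain
converges from every initial distribution on `S`. -/
theorem exists_stationary (hK : ∀ z, IsFinitelySupported (K z))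
    (hirr : IsIrreducibleOn K S) (haper : IsAperiodicOn K S)
    (hL : IsGeometricLyapunov K S L γ b) :
    ∃ Ξ : ProbabilityMeasure E, K.Invariant (Ξ : Measure E) ∧ (Ξ : Measure E) S = 1 ∧
      Integrable L (Ξ : Measure E) ∧
      ∀ (m : Measure E) [IsProbabilityMeasure m], m S = 1 → ∀ (φ : E → ℝ) (M : ℝ),
        (∀ z, |φ z| ≤ M) → Tendsto (fun n : ℕ => ∫ w, φ w ∂((K ^ n) ∘ₘ m)) atTop
          (𝓝 (∫ w, φ w ∂(Ξ : Measure E))) := by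
  obtain ⟨Ξ, hΞ⟩ := exists_limit_law hK hirr haper hL
  obtain ⟨z₀, hz₀⟩ := hirr.nonempty
  have hbdd : ∀ (φ : E → ℝ) (M : ℝ), (∀ z, |φ z| ≤ M) → ∀ (κ : Kernel E E) [IsMarkovKernel κ],
      ∀ z, |∫ w, φ w ∂(κ z)| ≤ M := fun φ M hφ κ _ z => by
    have := norm_integral_le_of_norm_le_const (μ := κ z) (f := φ) (C := M)
      (ae_of_all _ hφ)
    simpa using this
  have hind : ∀ (s : Set E) (z : E), |s.indicator (1 : E → ℝ) z| ≤ 1 := fun s z => by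
    by_cases h : z ∈ s <;> simp [h]
  refine ⟨Ξ, ?_, ?_, ?_, ?_⟩
  · have hreal : ∀ s : Set E, ∫ w, (K w).real s ∂(Ξ : Measure E) = (Ξ : Measure E).real s := by
      intro s
      have hs : MeasurableSet s := MeasurableSet.of_discrete
      have h1 := hΞ (s.indicator 1) 1 (hind s) z₀ hz₀
      have h2 := hΞ (fun w => ∫ y, s.indicator 1 y ∂(K w)) 1
        (hbdd _ 1 (hind s) K) z₀ hz₀
      have h3 := (tendsto_add_atTop_iff_nat 1).2 h1
      have h4 := tendsto_nhds_unique h2 (h3.congr fun n => by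
        rw [pow_succ']
        exact Kernel.integral_comp (integrable_of_abs_le (hind s)))
      simpa [integral_indicator_one hs] using h4
    refine Measure.ext fun s hs => ?_
    rw [Measure.bind_apply hs (Kernel.aemeasurable _), ← ofReal_measureReal, ← hreal s,
      ofReal_integral_eq_lintegral_ofReal]
    · exact lintegral_congr fun w => (ofReal_measureReal).symm
    · refine integrable_of_abs_le (M := 1) fun w => ?_
      rw [abs_of_nonneg measureReal_nonneg]
      exact measureReal_le_one
    · exact ae_of_all _ fun w => measureReal_nonneg
  · have h1 := hΞ (S.indicator 1) 1 (hind S) z₀ hz₀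
    have h2 : (Ξ : Measure E).real S = 1 := by
      rw [integral_indicator_one MeasurableSet.of_discrete] at h1
      refine tendsto_nhds_unique h1 (tendsto_const_nhds.congr fun n => ?_)
      rw [integral_indicator_one MeasurableSet.of_discrete]
      have := pow_compl_eq_zero hirr.closed n hz₀
      rw [prob_compl_eq_zero_iff MeasurableSet.of_discrete] at this
      simp [measureReal_def, this]
    rw [← ofReal_measureReal, h2, ENNReal.ofReal_one]
  · set M₀ := L z₀ + b / (1 - γ)
    refine ⟨Measurable.of_discrete.aestronglyMeasurable, ?_⟩
    rw [hasFiniteIntegral_iff_ofReal (ae_of_all _ hL.nonneg)]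
    refine lt_of_le_of_lt ?_ (ENNReal.ofReal_lt_top (r := M₀))
    have hmin : ∀ k : ℕ, ∫⁻ w, ENNReal.ofReal (min (L w) k) ∂(Ξ : Measure E) ≤
        ENNReal.ofReal M₀ := fun k => by
      have hb : ∀ z, |min (L z) (k : ℝ)| ≤ k := fun z => by
        rw [abs_of_nonneg (le_min (hL.nonneg z) (Nat.cast_nonneg k))]
        exact min_le_right _ _
      rw [← ofReal_integral_eq_lintegral_ofReal (integrable_of_abs_le hb)
        (ae_of_all _ fun z => le_min (hL.nonneg z) (Nat.cast_nonneg k))]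
      refine ENNReal.ofReal_le_ofReal (le_of_tendsto' (hΞ _ _ hb z₀ hz₀) fun n => ?_)
      refine le_trans ?_ (hL.integral_pow_le hK hirr.closed n hz₀)
      exact integral_mono (integrable_of_abs_le hb) ((IsFinitelySupported.pow hK n z₀).integrable L)
        fun z => min_le_left _ _
    calc ∫⁻ w, ENNReal.ofReal (L w) ∂(Ξ : Measure E)
        = ∫⁻ w, liminf (fun k : ℕ => ENNReal.ofReal (min (L w) k)) atTop ∂(Ξ : Measure E) := by
          refine lintegral_congr fun w => (Tendsto.liminf_eq ?_).symm
          refine tendsto_const_nhds.congr' ?_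
          filter_upwards [eventually_ge_atTop ⌈L w⌉₊] with k hk
          rw [min_eq_left (Nat.ceil_le.1 hk)]
      _ ≤ _ := lintegral_liminf_le fun k => Measurable.of_discrete
      _ ≤ ENNReal.ofReal M₀ :=
          liminf_le_of_frequently_le' (Frequently.of_forall hmin)
  · intro m _ hm φ M hφ
    have h1 : ∀ n : ℕ, ∫ w, φ w ∂((K ^ n) ∘ₘ m) = ∫ z, ∫ w, φ w ∂((K ^ n) z) ∂m := fun n =>
      integral_comp_measure (integrable_of_abs_le hφ)
    simp_rw [h1]
    have hmS : ∀ᵐ z ∂m, z ∈ S := by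
      rw [← prob_compl_eq_zero_iff MeasurableSet.of_discrete] at hm
      exact hm
    have h2 := tendsto_integral_of_dominated_convergence (μ := m)
      (F := fun n z => ∫ w, φ w ∂((K ^ n) z)) (f := fun _ => ∫ w, φ w ∂(Ξ : Measure E))
      (fun _ => M) (fun n => Measurable.of_discrete.aestronglyMeasurable)
      (integrable_const M) (fun n => ae_of_all _ (hbdd φ M hφ (K ^ n)))
      (by filter_upwards [hmS] with z hz using hΞ φ M hφ z hz)
    simpa using h2

end

/-- A measure to which the chain converges is the only stationary distribution. -/
lemma eq_of_invariant_of_tendsto {E : Type*} [MeasurableSpace E] {K : Kernel E E}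
    {m Ξ : Measure E} [IsProbabilityMeasure m] [IsProbabilityMeasure Ξ] (hm : K.Invariant m)
    (h : ∀ (φ : E → ℝ) (M : ℝ), (∀ z, |φ z| ≤ M) →
      Tendsto (fun n : ℕ => ∫ w, φ w ∂((K ^ n) ∘ₘ m)) atTop (𝓝 (∫ w, φ w ∂Ξ))) : m = Ξ := by
  refine Measure.ext fun s hs => ?_
  have h1 := h (s.indicator 1) 1 fun z => by by_cases h : z ∈ s <;> simp [h]
  simp only [invariant_pow hm, integral_indicator_one hs] at h1
  have h2 : m.real s = Ξ.real s := tendsto_nhds_unique tendsto_const_nhds h1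
  rw [← ofReal_measureReal, h2, ofReal_measureReal]

variable [Countable E]

/-- A stationary distribution on the state space of an irreducible chain charges every state. -/
lemma singleton_pos_of_invariant {S : Set E} (hirr : IsIrreducibleOn K S) {Ξ : Measure E}
    (hΞ : K.Invariant Ξ) (hS : Ξ S ≠ 0) {w : E} (hw : w ∈ S) : 0 < Ξ {w} := by
  obtain ⟨z, hz, hΞz⟩ : ∃ z ∈ S, 0 < Ξ {z} := by
    by_contra! hcon
    refine hS ?_
    rw [← Set.biUnion_of_singleton S, measure_biUnion_null_iff S.to_countable]
    exact fun z hz => le_antisymm (hcon z hz) zero_le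
  obtain ⟨n, hn⟩ := hirr.communicate z hz w hw
  rw [stepProb_eq_pow] at hn
  rw [← invariant_pow hΞ n, Measure.bind_apply (measurableSet_singleton w)
    (Kernel.aemeasurable _)]
  refine (ENNReal.mul_pos hn.ne' hΞz.ne').trans_le ?_
  rw [← lintegral_singleton (fun b => (K ^ n) b {w}) z]
  exact setLIntegral_le_lintegral _ _

lemma isPositiveRecurrentOn_of_invariant {S : Set E} (hirr : IsIrreducibleOn K S)
    {Ξ : Measure E} [IsProbabilityMeasure Ξ] (hΞ : K.Invariant Ξ) (hS : Ξ S ≠ 0) :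
    IsPositiveRecurrentOn K S := fun z hz => by
  have h1 := singleton_pos_of_invariant hirr hΞ hS hz
  have h2 := measure_singleton_mul_lintegral_returnTime_le K hΞ z
  by_contra h
  rw [not_lt, top_le_iff] at h
  rw [h, ENNReal.mul_top h1.ne'] at h2
  simp at h2

end Ergodic

/-! ### The Poisson equation of the arrival process -/

section Poisson

variable {Ω : Type*} [Fintype Ω] [MeasurableSpace Ω] [MeasurableSingletonClass Ω]
  (P : Kernel Ω Ω) [IsMarkovKernel P] (f : Ω → ℕ) (lam : ℝ)

/-- The expected centred arrivals `E[f (Xᵗ) - lam]` when the modulating chain starts at `x`. -/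
noncomputable def meanDev (t : ℕ) (x : Ω) : ℝ := ∫ y, ((f y : ℝ) - lam) ∂((P ^ t) x)

/-- The sum over all times of the expected centred arrivals: the solution of the Poisson equation
`h - P h = f - lam`. -/
noncomputable def poissonSol (x : Ω) : ℝ := ∑' t, meanDev P f lam t x

omit [Fintype Ω] [IsMarkovKernel P] in
lemma meanDev_zero (x : Ω) : meanDev P f lam 0 x = f x - lam := by
  change ∫ y, ((f y : ℝ) - lam) ∂(Kernel.id x) = _
  rw [Kernel.id_apply, integral_dirac]

lemma meanDev_succ (t : ℕ) (x : Ω) :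
    meanDev P f lam (t + 1) x = ∫ y, meanDev P f lam t y ∂(P x) := by
  unfold meanDev
  rw [pow_succ]
  exact Kernel.integral_comp Integrable.of_finite

lemma autocorr_eq (π : Measure Ω) [IsProbabilityMeasure π] (t : ℕ) :
    autocorr P f π lam t = ∫ x, meanDev P f lam t x * ((f x : ℝ) - lam) ∂π := by
  have h := integral_map (μ := chainLaw P π) (φ := fun ω => (ω 0, ω t)) (by fun_prop)
    (f := fun p : Ω × Ω => ((f p.2 : ℝ) - lam) * ((f p.1 : ℝ) - lam))
    Measurable.of_discrete.aestronglyMeasurable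
  unfold autocorr
  rw [← h, map_zero_nth_chainLaw, Measure.integral_compProd Integrable.of_finite]
  exact integral_congr_ae (ae_of_all _ fun x =>
    integral_mul_const ((f x : ℝ) - lam) fun y => (f y : ℝ) - lam)

/-- Geometric mixing, tested on deterministic initial states, bounds the terms of `poissonSol`. -/
lemma GeometricMixing.abs_meanDev_le {α C : ℝ} (h : GeometricMixing P f lam α C) {t : ℕ}
    (ht : 1 ≤ t) (x : Ω) :
    |meanDev P f lam t x| ≤ 2 * ((Finset.univ.sup f : ℕ) : ℝ) * C * α ^ t := by
  have h1 := h t ht ⟨Measure.dirac x, inferInstance⟩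
  have h2 := integral_map (μ := chainLaw P (Measure.dirac x)) (φ := fun ω => ω t)
    (measurable_pi_apply t).aemeasurable
    (f := fun y : Ω => (f y : ℝ) - lam) Measurable.of_discrete.aestronglyMeasurable
  rw [map_nth_chainLaw, Measure.dirac_bind (Kernel.measurable _)] at h2
  simp only [ProbabilityMeasure.coe_mk] at h1
  rw [← h2] at h1
  exact h1

variable {P f lam} {B α : ℝ}

omit [Fintype Ω] [MeasurableSingletonClass Ω] [IsMarkovKernel P] in
lemma summable_meanDev (hα0 : 0 ≤ α) (hα1 : α < 1)
    (hB : ∀ t x, |meanDev P f lam t x| ≤ B * α ^ t) (x : Ω) :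
    Summable fun t => meanDev P f lam t x :=
  Summable.of_norm_bounded ((summable_geometric_of_lt_one hα0 hα1).mul_left B) fun t => hB t x

omit [Fintype Ω] [MeasurableSingletonClass Ω] [IsMarkovKernel P] in
lemma abs_poissonSol_le (hα0 : 0 ≤ α) (hα1 : α < 1)
    (hB : ∀ t x, |meanDev P f lam t x| ≤ B * α ^ t) (x : Ω) :
    |poissonSol P f lam x| ≤ B / (1 - α) := by
  have h := tsum_of_norm_bounded (f := fun t => meanDev P f lam t x)
    ((hasSum_geometric_of_lt_one hα0 hα1).mul_left B) fun t => hB t x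
  rwa [← div_eq_mul_inv] at h

omit [IsMarkovKernel P] in
lemma hasSum_integral_meanDev_mul (hα0 : 0 ≤ α) (hα1 : α < 1)
    (hB : ∀ t x, |meanDev P f lam t x| ≤ B * α ^ t) (m : Measure Ω) [IsFiniteMeasure m]
    (g : Ω → ℝ) :
    HasSum (fun t => ∫ x, meanDev P f lam t x * g x ∂m) (∫ x, poissonSol P f lam x * g x ∂m) := by
  have hs : ∀ x, Summable fun t => |meanDev P f lam t x| := fun x =>
    (summable_meanDev hα0 hα1 hB x).abs
  have h := hasSum_integral_of_summable_integral_norm (μ := m)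
    (F := fun t x => meanDev P f lam t x * g x) (fun t => Integrable.of_finite) (by
      simp_rw [integral_fintype Integrable.of_finite]
      refine summable_sum fun x _ => ?_
      simp only [norm_mul, Real.norm_eq_abs, smul_eq_mul]
      exact ((hs x).mul_right _).mul_left _)
  simp_rw [tsum_mul_right] at h
  exact h

lemma poissonSol_sub (hα0 : 0 ≤ α) (hα1 : α < 1)
    (hB : ∀ t x, |meanDev P f lam t x| ≤ B * α ^ t) (x : Ω) :
    poissonSol P f lam x - ∫ y, poissonSol P f lam y ∂(P x) = f x - lam := by
  have h1 := hasSum_integral_meanDev_mul hα0 hα1 hB (P x) 1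
  simp only [Pi.one_apply, mul_one, ← meanDev_succ] at h1
  have h2 : poissonSol P f lam x = meanDev P f lam 0 x + ∑' t, meanDev P f lam (t + 1) x :=
    (summable_meanDev hα0 hα1 hB x).tsum_eq_zero_add
  rw [h2, h1.tsum_eq, meanDev_zero]
  ring

lemma abs_autocorr_le (hα0 : 0 ≤ α) (hB0 : 0 ≤ B)
    (hB : ∀ t x, |meanDev P f lam t x| ≤ B * α ^ t) (π : Measure Ω) [IsProbabilityMeasure π]
    (t : ℕ) : |autocorr P f π lam t| ≤ B * B * α ^ t := by
  rw [autocorr_eq]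
  have h := norm_integral_le_of_norm_le_const (μ := π) (C := B * B * α ^ t)
    (f := fun x => meanDev P f lam t x * ((f x : ℝ) - lam)) (ae_of_all _ fun x => by
      have h0 := hB 0 x
      rw [meanDev_zero, pow_zero, mul_one] at h0
      rw [Real.norm_eq_abs, abs_mul]
      calc _ ≤ B * α ^ t * B := mul_le_mul (hB t x) h0 (abs_nonneg _) (by positivity)
        _ = _ := by ring)
  simpa using h

/-- The Green-Kubo formula: the stationary variance of the martingale increments
`h (Xᵗ⁺¹) - P h (Xᵗ)` is the asymptotic variance of the arrival process. -/
lemma integral_condVar_poissonSol (hα0 : 0 ≤ α) (hα1 : α < 1)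
    (hB : ∀ t x, |meanDev P f lam t x| ≤ B * α ^ t) {π : Measure Ω} [IsProbabilityMeasure π]
    (hπ : P.Invariant π) :
    ∫ x, (∫ y, poissonSol P f lam y ^ 2 ∂(P x) - (∫ y, poissonSol P f lam y ∂(P x)) ^ 2) ∂π =
      autocorr P f π lam 0 + 2 * ∑' t, autocorr P f π lam (t + 1) := by
  set h := poissonSol P f lam
  have hP : ∀ x, ∫ y, h y ∂(P x) = h x - ((f x : ℝ) - lam) := fun x => by
    have := poissonSol_sub hα0 hα1 hB x
    linarith
  have hsum : HasSum (fun t => autocorr P f π lam t) (∫ x, h x * ((f x : ℝ) - lam) ∂π) := by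
    simp_rw [autocorr_eq]
    exact hasSum_integral_meanDev_mul hα0 hα1 hB π _
  have h0 : autocorr P f π lam 0 = ∫ x, ((f x : ℝ) - lam) * ((f x : ℝ) - lam) ∂π := by
    rw [autocorr_eq]
    simp_rw [meanDev_zero]
  have hinv : ∫ x, ∫ y, h y ^ 2 ∂(P x) ∂π = ∫ x, h x ^ 2 ∂π := by
    rw [← integral_comp_measure (κ := P) (m := π) Integrable.of_finite]
    exact congrArg (fun m => ∫ x, h x ^ 2 ∂m) hπ.def
  have htsum := hsum.summable.tsum_eq_zero_add
  rw [hsum.tsum_eq] at htsum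
  rw [integral_sub Integrable.of_finite Integrable.of_finite, hinv,
    ← integral_sub Integrable.of_finite Integrable.of_finite]
  simp_rw [hP]
  have : ∀ x, h x ^ 2 - (h x - ((f x : ℝ) - lam)) ^ 2 =
      2 * (h x * ((f x : ℝ) - lam)) - ((f x : ℝ) - lam) * ((f x : ℝ) - lam) := fun x => by ring
  simp_rw [this]
  rw [integral_sub Integrable.of_finite Integrable.of_finite, integral_const_mul, htsum, ← h0]
  ring

end Poisson

/-! ### One step of the queue -/

section Queue

variable {Ω : Type*} [Fintype Ω] [MeasurableSpace Ω] [MeasurableSingletonClass Ω]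
  {P : Kernel Ω Ω} [IsMarkovKernel P] {f : Ω → ℕ} {ν : Measure ℕ} [IsProbabilityMeasure ν]

omit [IsMarkovKernel P] [IsProbabilityMeasure ν] in
lemma isFinitelySupported_queueKernel (z : ℕ × Ω) :
    IsFinitelySupported (queueKernel P f ν z) := by
  have hfin : (Set.Iic (z.1 + f z.2) ×ˢ (Set.univ : Set Ω)).Finite :=
    (Set.finite_Iic _).prod Set.finite_univ
  refine ⟨_, hfin, ?_⟩
  change ((ν.prod (P z.2)).map _) _ = 0
  rw [Measure.map_apply Measurable.of_discrete hfin.measurableSet.compl]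
  refine measure_mono_null (t := ∅) (fun w hw => hw ?_) measure_empty
  exact ⟨Nat.sub_le _ _, Set.mem_univ _⟩

omit [IsMarkovKernel P] [IsProbabilityMeasure ν] in
lemma integral_queueKernel (z : ℕ × Ω) (φ : ℕ × Ω → ℝ) :
    ∫ w, φ w ∂(queueKernel P f ν z) =
      ∫ w : ℕ × Ω, φ (z.1 + f z.2 - w.1, w.2) ∂(ν.prod (P z.2)) :=
  integral_map Measurable.of_discrete.aemeasurable Measurable.of_discrete.aestronglyMeasurable

omit [MeasurableSingletonClass Ω] [IsMarkovKernel P] [IsProbabilityMeasure ν] in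
lemma isFinitelySupported_prod {Smax : ℕ} (hS : ∀ᵐ s ∂ν, s ≤ Smax) (x : Ω) :
    IsFinitelySupported (ν.prod (P x)) := by
  refine ⟨Set.Iic Smax ×ˢ Set.univ, (Set.finite_Iic _).prod Set.finite_univ, ?_⟩
  have h := Measure.quasiMeasurePreserving_fst (μ := ν) (ν := P x) |>.ae hS
  have : {w : ℕ × Ω | w.1 ≤ Smax} = Set.Iic Smax ×ˢ Set.univ := by ext; simp
  rw [← this]
  exact h

/-- The second marginal of a stationary distribution of the queue is stationary for the modulating
chain. -/
lemma invariant_map_snd {Ξ : Measure (ℕ × Ω)} (hΞ : (queueKernel P f ν).Invariant Ξ) :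
    P.Invariant (Ξ.map Prod.snd) := by
  refine Measure.ext fun s hs => ?_
  rw [Measure.bind_apply hs (Kernel.aemeasurable _),
    lintegral_map (Kernel.measurable_coe P hs) measurable_snd,
    Measure.map_apply measurable_snd hs]
  conv_rhs => rw [← hΞ.def]
  rw [Measure.bind_apply (measurable_snd hs) (Kernel.aemeasurable _)]
  refine lintegral_congr fun z => ?_
  change P z.2 s = ((ν.prod (P z.2)).map _) _
  rw [Measure.map_apply Measurable.of_discrete (measurable_snd hs)]
  have : (fun w : ℕ × Ω => (z.1 + f z.2 - w.1, w.2)) ⁻¹' (Prod.snd ⁻¹' s) =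
      Set.univ ×ˢ s := by ext; simp
  rw [this, Measure.prod_prod, measure_univ, one_mul]

/-- The mean unused service in one step from `z`. -/
noncomputable def meanUnused (f : Ω → ℕ) (ν : Measure ℕ) (z : ℕ × Ω) : ℝ :=
  ∫ s : ℕ, ((s - (z.1 + f z.2) : ℕ) : ℝ) ∂ν

/-- The increment of `q + h x` over one step, up to the unused service: `w` is the pair of the
potential service and the next state of the modulating chain. -/
def netInput (f : Ω → ℕ) (h : Ω → ℝ) (x : Ω) (w : ℕ × Ω) : ℝ := f x - w.1 + h w.2 - h x

omit [Fintype Ω] [MeasurableSpace Ω] [MeasurableSingletonClass Ω] in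
lemma next_eq (h : Ω → ℝ) (z w : ℕ × Ω) :
    ((z.1 + f z.2 - w.1 : ℕ) : ℝ) + h w.2 =
      z.1 + h z.2 + netInput f h z.2 w + ((w.1 - (z.1 + f z.2) : ℕ) : ℝ) := by
  have : ((z.1 + f z.2 - w.1 : ℕ) : ℝ) + w.1 = z.1 + f z.2 + ((w.1 - (z.1 + f z.2) : ℕ) : ℝ) := by
    norm_cast
    omega
  unfold netInput
  linarith

section Moments

variable {h : Ω → ℝ} {μ ε : ℝ} {Smax : ℕ} (hS : ∀ᵐ s ∂ν, s ≤ Smax)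
  (hμ : ∫ s : ℕ, (s : ℝ) ∂ν = μ) (hh : ∀ x, h x - ∫ y, h y ∂(P x) = f x - (μ - ε))

include hS hμ hh

lemma integral_netInput (x : Ω) : ∫ w, netInput f h x w ∂(ν.prod (P x)) = -ε := by
  have hi := (isFinitelySupported_prod (P := P) hS x).integrable
  unfold netInput
  rw [integral_sub (hi _) (hi _), integral_add (hi _) (hi _), integral_sub (hi _) (hi _)]
  rw [integral_fun_fst (fun s : ℕ => (s : ℝ)), integral_fun_snd h]
  simp [hμ]
  linarith [hh x]

lemma integral_netInput_sq {σs2 : ℝ} (hσs : Var[fun s : ℕ => (s : ℝ); ν] = σs2) (x : Ω) :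
    ∫ w, netInput f h x w ^ 2 ∂(ν.prod (P x)) =
      σs2 + ε ^ 2 + (∫ y, h y ^ 2 ∂(P x) - (∫ y, h y ∂(P x)) ^ 2) := by
  have hi := (isFinitelySupported_prod (P := P) hS x).integrable
  have hiν : ∀ φ : ℕ → ℝ, Integrable φ ν := fun φ =>
    IsFinitelySupported.integrable ⟨Set.Iic Smax, Set.finite_Iic _, hS⟩ φ
  set m := ∫ y, h y ∂(P x) with hm
  have hvar : ∫ s : ℕ, (μ - (s : ℝ)) ^ 2 ∂ν = σs2 := by
    rw [← hσs, variance_eq_integral Measurable.of_discrete.aemeasurable, hμ]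
    exact integral_congr_ae (ae_of_all _ fun s => by ring)
  have hmean : ∫ s : ℕ, (μ - (s : ℝ)) ∂ν = 0 := by
    rw [integral_sub (hiν _) (hiν _), hμ]; simp
  have hx : ∀ w : ℕ × Ω, netInput f h x w ^ 2 =
      (μ - (w.1 : ℝ)) ^ 2 + 2 * ((μ - (w.1 : ℝ)) * (h w.2 - m - ε)) + (h w.2 - m - ε) ^ 2 := by
    intro w
    have : netInput f h x w = (μ - w.1) + (h w.2 - m - ε) := by
      unfold netInput; linarith [hh x]
    rw [this]; ring
  have hlast : ∫ y, (h y - m - ε) ^ 2 ∂(P x) = ε ^ 2 + (∫ y, h y ^ 2 ∂(P x) - m ^ 2) := by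
    have : ∀ y, (h y - m - ε) ^ 2 = h y ^ 2 - 2 * (m + ε) * h y + (m + ε) ^ 2 := fun y => by ring
    simp_rw [this]
    rw [integral_add Integrable.of_finite Integrable.of_finite,
      integral_sub Integrable.of_finite Integrable.of_finite, integral_const_mul, ← hm]
    simp
    ring
  simp_rw [hx]
  rw [integral_add (hi _) (hi _), integral_add (hi _) (hi _), integral_const_mul,
    integral_prod_mul (fun s : ℕ => μ - (s : ℝ)) (fun y => h y - m - ε), hmean,
    integral_fun_fst (fun s : ℕ => (μ - (s : ℝ)) ^ 2),
    integral_fun_snd (fun y => (h y - m - ε) ^ 2), hvar, hlast]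
  simp
  ring

/-- The drift of `q + h x` is `-ε`, up to the unused service. -/
lemma integral_queueKernel_lyapunov (z : ℕ × Ω) :
    ∫ w, ((w.1 : ℝ) + h w.2) ∂(queueKernel P f ν z) = z.1 + h z.2 - ε + meanUnused f ν z := by
  have hi := (isFinitelySupported_prod (P := P) hS z.2).integrable
  rw [integral_queueKernel]
  simp_rw [next_eq]
  rw [integral_add (hi _) (hi _), integral_add (hi _) (hi _), integral_netInput hS hμ hh,
    integral_fun_fst (fun s : ℕ => ((s - (z.1 + f z.2) : ℕ) : ℝ))]
  simp [meanUnused]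
  ring

/-- The drift of `(q + h x) ^ 2`. The cross term between the queue length and the unused service
vanishes, since service is unused only when the queue empties. -/
lemma abs_drift_sq_le {σs2 H : ℝ} (hσs : Var[fun s : ℕ => (s : ℝ); ν] = σs2)
    (hH : ∀ x, |h x| ≤ H) (z : ℕ × Ω) :
    |∫ w, ((w.1 : ℝ) + h w.2) ^ 2 ∂(queueKernel P f ν z) - (z.1 + h z.2) ^ 2
        + 2 * ε * (z.1 + h z.2)
        - (σs2 + ε ^ 2 + (∫ y, h y ^ 2 ∂(P z.2) - (∫ y, h y ∂(P z.2)) ^ 2))| ≤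
      (2 * H + Smax) * meanUnused f ν z := by
  have hi := (isFinitelySupported_prod (P := P) hS z.2).integrable
  set V := (z.1 : ℝ) + h z.2
  set U : ℕ × Ω → ℝ := fun w => ((w.1 - (z.1 + f z.2) : ℕ) : ℝ) with hU
  have hV : ∀ w : ℕ × Ω, (((z.1 + f z.2 - w.1 : ℕ) : ℝ) + h w.2) ^ 2 =
      V ^ 2 + 2 * V * netInput f h z.2 w + netInput f h z.2 w ^ 2
        + (2 * h w.2 * U w - U w ^ 2) := by
    intro w
    have h1 := next_eq (f := f) h z w
    have h2 : ((z.1 + f z.2 - w.1 : ℕ) : ℝ) * U w = 0 := by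
      simp only [hU]
      norm_cast
      rw [mul_eq_zero]
      omega
    have h3 : V + netInput f h z.2 w = ((z.1 + f z.2 - w.1 : ℕ) : ℝ) + h w.2 - U w := by
      linarith
    have h4 : V ^ 2 + 2 * V * netInput f h z.2 w + netInput f h z.2 w ^ 2 =
      (((z.1 + f z.2 - w.1 : ℕ) : ℝ) + h w.2 - U w) ^ 2 := by rw [← h3]; ring
    rw [h4]
    linear_combination 2 * h2
  have hmain : ∫ w, ((w.1 : ℝ) + h w.2) ^ 2 ∂(queueKernel P f ν z) - V ^ 2
        + 2 * ε * V - (σs2 + ε ^ 2 + (∫ y, h y ^ 2 ∂(P z.2) - (∫ y, h y ∂(P z.2)) ^ 2)) =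
      ∫ w : ℕ × Ω, (2 * h w.2 * U w - U w ^ 2) ∂(ν.prod (P z.2)) := by
    rw [integral_queueKernel]
    simp_rw [hV]
    rw [integral_add (hi _) (hi _), integral_add (hi _) (hi _), integral_add (hi _) (hi _),
      integral_const_mul, integral_netInput hS hμ hh, integral_netInput_sq hS hμ hh hσs]
    simp
    ring
  rw [hmain]
  have hUint : ∫ w, U w ∂(ν.prod (P z.2)) = meanUnused f ν z := by
    rw [hU, integral_fun_fst (fun s : ℕ => ((s - (z.1 + f z.2) : ℕ) : ℝ))]
    simp [meanUnused]
  rw [← hUint, ← integral_const_mul, ← Real.norm_eq_abs]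
  refine norm_integral_le_of_norm_le (hi _) ?_
  have hae := Measure.quasiMeasurePreserving_fst (μ := ν) (ν := P z.2) |>.ae hS
  filter_upwards [hae] with w hw
  have hU0 : 0 ≤ U w := Nat.cast_nonneg _
  have hU1 : U w ≤ Smax := Nat.cast_le.2 (by omega)
  rw [Real.norm_eq_abs]
  calc |2 * h w.2 * U w - U w ^ 2| = |2 * h w.2 - U w| * U w := by
        rw [← abs_of_nonneg hU0, ← abs_mul, abs_of_nonneg hU0]; congr 1; ring
    _ ≤ (2 * H + Smax) * U w := by
        refine mul_le_mul_of_nonneg_right ?_ hU0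
        have := abs_le.1 (hH w.2)
        exact abs_le.2 ⟨by linarith, by linarith [hH w.2, Nat.cast_nonneg (α := ℝ) Smax]⟩

end Moments

end Queue

/-! ### The steady state of the queue -/

section SteadyState

variable {Ω : Type*} [Fintype Ω] [MeasurableSpace Ω] [MeasurableSingletonClass Ω]
  {P : Kernel Ω Ω} [IsMarkovKernel P] {f : Ω → ℕ} {ν : Measure ℕ} [IsProbabilityMeasure ν]
  {h : Ω → ℝ} {μ ε H : ℝ} {Smax : ℕ}

omit [Fintype Ω] [MeasurableSpace Ω] [MeasurableSingletonClass Ω] [IsProbabilityMeasure ν] in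
lemma meanUnused_nonneg (z : ℕ × Ω) : 0 ≤ meanUnused f ν z :=
  integral_nonneg fun _ => Nat.cast_nonneg _

omit [Fintype Ω] [MeasurableSpace Ω] [MeasurableSingletonClass Ω] in
lemma meanUnused_le (hS : ∀ᵐ s ∂ν, s ≤ Smax) (z : ℕ × Ω) : meanUnused f ν z ≤ Smax := by
  have h1 := norm_integral_le_of_norm_le_const (μ := ν) (C := Smax)
    (f := fun s : ℕ => ((s - (z.1 + f z.2) : ℕ) : ℝ)) (by
      filter_upwards [hS] with s hs
      rw [Real.norm_of_nonneg (Nat.cast_nonneg _)]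
      exact Nat.cast_le.2 (by omega))
  exact (le_abs_self _).trans (by simpa [meanUnused] using h1)

/-- When `q + h x` has drift `-ε` away from the origin, a small exponential of it is a geometric
Lyapunov function. -/
lemma exists_isGeometricLyapunov (hS : ∀ᵐ s ∂ν, s ≤ Smax) (hμ : ∫ s : ℕ, (s : ℝ) ∂ν = μ)
    (hε : 0 < ε) (hh : ∀ x, h x - ∫ y, h y ∂(P x) = f x - (μ - ε)) (hH0 : 0 ≤ H)
    (hH : ∀ x, |h x| ≤ H) (S : Set (ℕ × Ω)) :
    ∃ θ γ b : ℝ, 0 < θ ∧ IsGeometricLyapunov (queueKernel P f ν) S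
      (fun z => Real.exp (θ * (z.1 + h z.2))) γ b := by
  set A : ℕ := Finset.univ.sup f
  have hA : ∀ x, f x ≤ A := fun x => Finset.le_sup (Finset.mem_univ x)
  -- `B` bounds the increments and `ε`; `θ` minimizes the rate `1 - θ ε + (θ B) ^ 2`
  set B : ℝ := A + Smax + 2 * H + 1 + ε with hB
  have hB0 : 0 < B := by positivity
  set θ := ε / (2 * B ^ 2) with hθ
  have hθ0 : 0 < θ := by positivity
  have hθB : θ * B ≤ 1 := by
    have : θ * B = (ε / B) / 2 := by rw [hθ]; field_simp
    have h2 : ε / B ≤ 1 := (div_le_one hB0).2 (by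
      have : (0 : ℝ) ≤ A := Nat.cast_nonneg _
      have : (0 : ℝ) ≤ Smax := Nat.cast_nonneg _
      linarith)
    linarith
  have hrate : 1 - θ * ε + (θ * B) ^ 2 = 1 - (ε / B) ^ 2 / 4 := by
    rw [hθ]; field_simp; ring
  have hrate0 : 0 ≤ (1 - θ * ε + (θ * B) ^ 2) := by
    rw [hrate]
    have h2 : ε / B ≤ 1 := (div_le_one hB0).2 (by
      have : (0 : ℝ) ≤ A := Nat.cast_nonneg _
      have : (0 : ℝ) ≤ Smax := Nat.cast_nonneg _
      linarith)
    have h3 : 0 ≤ ε / B := by positivity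
    nlinarith
  set b := Real.exp (θ * (Smax + A + H)) with hb
  refine ⟨θ, 1 - θ * ε + (θ * B) ^ 2, b, hθ0, fun z => (Real.exp_pos _).le, fun R => ?_,
    hrate0, ?_, (Real.exp_pos _).le, fun z _ => ?_⟩
  · refine ((Set.finite_Iic ⌈R / θ + H⌉₊).prod (Set.finite_univ (α := Ω))).subset ?_
    rintro ⟨q, x⟩ ⟨-, hz⟩
    refine ⟨?_, Set.mem_univ _⟩
    have h1 := (Real.add_one_le_exp _).trans hz
    have h2 : θ * (q + h x) ≤ R := by linarith
    have h3 : (q : ℝ) ≤ R / θ + H := by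
      have h4 : (q : ℝ) + h x ≤ R / θ := by rw [le_div_iff₀ hθ0]; linarith
      linarith [(abs_le.1 (hH x)).1]
    exact Nat.cast_le.1 (h3.trans (Nat.le_ceil _))
  · rw [hrate]
    have : 0 < (ε / B) ^ 2 := by positivity
    linarith
  · have hi := (isFinitelySupported_prod (P := P) hS z.2).integrable
    have hae := Measure.quasiMeasurePreserving_fst (μ := ν) (ν := P z.2) |>.ae hS
    have hL0 : 0 < Real.exp (θ * (z.1 + h z.2)) := Real.exp_pos _
    rw [integral_queueKernel]
    dsimp only
    rcases lt_or_ge z.1 Smax with hq | hq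
    · -- below level `Smax` the queue can only reach a bounded region
      have h1 : ∫ w : ℕ × Ω, Real.exp (θ * (((z.1 + f z.2 - w.1 : ℕ) : ℝ) + h w.2))
          ∂(ν.prod (P z.2)) ≤ ∫ w : ℕ × Ω, b ∂(ν.prod (P z.2)) := by
        refine integral_mono (hi _) (hi _) fun w => Real.exp_le_exp.2 ?_
        refine mul_le_mul_of_nonneg_left ?_ hθ0.le
        have h2 : ((z.1 + f z.2 - w.1 : ℕ) : ℝ) ≤ Smax + A := by
          norm_cast
          have := hA z.2
          omega
        linarith [(abs_le.1 (hH w.2)).2]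
      have h2 : ∫ w : ℕ × Ω, b ∂(ν.prod (P z.2)) = b := by simp
      have h3 := mul_nonneg hrate0 hL0.le
      linarith
    · -- above level `Smax` no service is unused
      have h1 : ∫ w : ℕ × Ω, Real.exp (θ * (((z.1 + f z.2 - w.1 : ℕ) : ℝ) + h w.2))
          ∂(ν.prod (P z.2)) ≤ ∫ w : ℕ × Ω, Real.exp (θ * (z.1 + h z.2)) *
            (1 + θ * netInput f h z.2 w + (θ * B) ^ 2) ∂(ν.prod (P z.2)) := by
        refine integral_mono_ae (hi _) (hi _) ?_
        filter_upwards [hae] with w hw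
        have h2 : w.1 - (z.1 + f z.2) = 0 := by omega
        rw [next_eq, h2, Nat.cast_zero, add_zero, mul_add, Real.exp_add]
        refine mul_le_mul_of_nonneg_left ?_ hL0.le
        have hD : |netInput f h z.2 w| ≤ B := by
          have h3 : (w.1 : ℝ) ≤ Smax := Nat.cast_le.2 hw
          have h4 : (f z.2 : ℝ) ≤ A := Nat.cast_le.2 (hA _)
          have h5 : (0 : ℝ) ≤ w.1 := Nat.cast_nonneg _
          have h6 : (0 : ℝ) ≤ f z.2 := Nat.cast_nonneg _
          have h7 := abs_le.1 (hH w.2)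
          have h8 := abs_le.1 (hH z.2)
          unfold netInput
          exact abs_le.2 ⟨by linarith, by linarith⟩
        have hθD : |θ * netInput f h z.2 w| ≤ θ * B := by
          rw [abs_mul, abs_of_pos hθ0]
          exact mul_le_mul_of_nonneg_left hD hθ0.le
        have h3 := (abs_le.1 (Real.abs_exp_sub_one_sub_id_le (hθD.trans hθB))).2
        have h4 := sq_le_sq' (abs_le.1 hθD).1 (abs_le.1 hθD).2
        linarith
      refine h1.trans ?_
      rw [integral_const_mul, integral_add (hi _) (hi _), integral_add (hi _) (hi _),
        integral_const_mul, integral_netInput hS hμ hh]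
      have h2 : (0 : ℝ) ≤ b := (Real.exp_pos _).le
      simp
      linarith

lemma integral_of_invariant {E : Type*} [MeasurableSpace E] {K : Kernel E E} {Ξ : Measure E}
    (hΞ : K.Invariant Ξ) {φ : E → ℝ} (hφ : Integrable φ Ξ) :
    Integrable (fun z => ∫ w, φ w ∂(K z)) Ξ ∧ ∫ z, ∫ w, φ w ∂(K z) ∂Ξ = ∫ z, φ z ∂Ξ := by
  have hφ' : Integrable φ (Ξ.bind K) := by rwa [hΞ.def]
  refine ⟨?_, ?_⟩
  · have h := Integrable.integral_comp (a := ()) (κ := Kernel.const Unit Ξ) (η := K) (f := φ)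
    rw [Kernel.comp_const] at h
    exact h hφ'
  · rw [← integral_comp_measure hφ']
    exact congrArg (fun m => ∫ z, φ z ∂m) hΞ.def

/-- The second moment identity in steady state: `(q + h x) ^ 2` has zero mean drift. -/
lemma abs_integral_queue_sub_le {Ξ : Measure (ℕ × Ω)} [IsProbabilityMeasure Ξ]
    (hS : ∀ᵐ s ∂ν, s ≤ Smax) (hμ : ∫ s : ℕ, (s : ℝ) ∂ν = μ) (hε : 0 < ε)
    (hh : ∀ x, h x - ∫ y, h y ∂(P x) = f x - (μ - ε)) (hH : ∀ x, |h x| ≤ H)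
    {σs2 : ℝ} (hσs : Var[fun s : ℕ => (s : ℝ); ν] = σs2)
    (hΞ : (queueKernel P f ν).Invariant Ξ)
    (hsq : Integrable (fun z : ℕ × Ω => (z.1 : ℝ) ^ 2) Ξ) :
    |2 * ε * ∫ z, (z.1 : ℝ) ∂Ξ - (σs2 + ε ^ 2 +
        ∫ x, (∫ y, h y ^ 2 ∂(P x) - (∫ y, h y ∂(P x)) ^ 2) ∂(Ξ.map Prod.snd))| ≤
      (4 * H + Smax) * ε := by
  set v : Ω → ℝ := fun x => ∫ y, h y ^ 2 ∂(P x) - (∫ y, h y ∂(P x)) ^ 2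
  have hmeas : ∀ φ : ℕ × Ω → ℝ, AEStronglyMeasurable φ Ξ := fun φ =>
    Measurable.of_discrete.aestronglyMeasurable
  have hq : Integrable (fun z : ℕ × Ω => (z.1 : ℝ)) Ξ := by
    refine ((integrable_const 1).add hsq).mono' (hmeas _) (ae_of_all _ fun z => ?_)
    rw [Real.norm_of_nonneg (Nat.cast_nonneg _)]
    simp only [Pi.add_apply]
    nlinarith [sq_nonneg ((z.1 : ℝ) - 1)]
  have hhi : Integrable (fun z : ℕ × Ω => h z.2) Ξ := integrable_of_abs_le fun z => hH z.2
  have hV : Integrable (fun z : ℕ × Ω => (z.1 : ℝ) + h z.2) Ξ := hq.add hhi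
  have hV2 : Integrable (fun z : ℕ × Ω => ((z.1 : ℝ) + h z.2) ^ 2) Ξ := by
    refine ((hsq.const_mul 2).add (integrable_const (2 * H ^ 2))).mono' (hmeas _)
      (ae_of_all _ fun z => ?_)
    rw [Real.norm_of_nonneg (sq_nonneg _)]
    have h1 : h z.2 ^ 2 ≤ H ^ 2 := sq_le_sq' (abs_le.1 (hH z.2)).1 (abs_le.1 (hH z.2)).2
    simp only [Pi.add_apply]
    nlinarith [sq_nonneg ((z.1 : ℝ) - h z.2)]
  have hu : Integrable (meanUnused f ν) Ξ := integrable_of_abs_le (M := Smax) fun z => by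
    rw [abs_of_nonneg (meanUnused_nonneg z)]
    exact meanUnused_le hS z
  have hvi : Integrable (fun z : ℕ × Ω => σs2 + ε ^ 2 + v z.2) Ξ := by
    refine (integrable_const (σs2 + ε ^ 2)).add ?_
    exact (Integrable.of_finite (f := v) (μ := Ξ.map Prod.snd)).comp_measurable measurable_snd
  -- stationarity of `q + h x`: in the mean, the unused service is `ε`
  have hu_eq : ∫ z, meanUnused f ν z ∂Ξ = ε := by
    have h1 := (integral_of_invariant hΞ hV).2
    simp_rw [integral_queueKernel_lyapunov hS hμ hh] at h1
    have hVε : Integrable (fun z : ℕ × Ω => (z.1 : ℝ) + h z.2 - ε) Ξ :=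
      hV.sub (integrable_const ε)
    rw [integral_add hVε hu, integral_sub hV (integrable_const ε)] at h1
    simp at h1
    linarith
  obtain ⟨hTi, hTe⟩ := integral_of_invariant hΞ hV2
  set T : ℕ × Ω → ℝ := fun z => ∫ w, ((w.1 : ℝ) + h w.2) ^ 2 ∂(queueKernel P f ν z)
  have hT1 : Integrable (fun z : ℕ × Ω => T z - ((z.1 : ℝ) + h z.2) ^ 2) Ξ := hTi.sub hV2
  have hT2 : Integrable (fun z : ℕ × Ω => T z - ((z.1 : ℝ) + h z.2) ^ 2
      + 2 * ε * (z.1 + h z.2)) Ξ := hT1.add (hV.const_mul (2 * ε))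
  have hr : ‖∫ z, (T z - ((z.1 : ℝ) + h z.2) ^ 2 + 2 * ε * (z.1 + h z.2)
      - (σs2 + ε ^ 2 + v z.2)) ∂Ξ‖ ≤ ∫ z, (2 * H + Smax) * meanUnused f ν z ∂Ξ :=
    norm_integral_le_of_norm_le (hu.const_mul (2 * H + Smax)) (ae_of_all Ξ fun z =>
      (Real.norm_eq_abs _).trans_le (abs_drift_sq_le hS hμ hh hσs hH z))
  have hvi' : Integrable (fun z : ℕ × Ω => v z.2) Ξ :=
    (Integrable.of_finite (f := v) (μ := Ξ.map Prod.snd)).comp_measurable measurable_snd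
  rw [integral_sub hT2 hvi, integral_add hT1 (hV.const_mul (2 * ε)), integral_sub hTi hV2, hTe,
    sub_self, zero_add, integral_const_mul, integral_const_mul, hu_eq, integral_add hq hhi,
    integral_add (integrable_const _) hvi', Real.norm_eq_abs] at hr
  rw [integral_map measurable_snd.aemeasurable Measurable.of_discrete.aestronglyMeasurable]
  simp only [integral_const, probReal_univ, one_smul] at hr
  have hhb : |∫ z, h z.2 ∂Ξ| ≤ H := by
    have := norm_integral_le_of_norm_le_const (μ := Ξ) (C := H) (f := fun z => h z.2)
      (ae_of_all _ fun z => hH z.2)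
    simpa using this
  obtain ⟨h1, h2⟩ := abs_le.1 hr
  obtain ⟨h3, h4⟩ := abs_le.1 hhb
  have h5 := mul_le_mul_of_nonneg_left h3 hε.le
  have h6 := mul_le_mul_of_nonneg_left h4 hε.le
  exact abs_le.2 ⟨by linarith, by linarith⟩

/-- The stationary distribution of an irreducible aperiodic chain on a finite state space is
unique. -/
lemma invariant_unique_of_fintype (hirr : IsIrreducibleOn P Set.univ)
    (haper : IsAperiodicOn P Set.univ) {m m' : Measure Ω} [IsProbabilityMeasure m]
    [IsProbabilityMeasure m'] (hm : P.Invariant m) (hm' : P.Invariant m') : m = m' := by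
  have hL : IsGeometricLyapunov P Set.univ (fun _ : Ω => (0 : ℝ)) 0 0 :=
    ⟨fun _ => le_rfl, fun _ => Set.toFinite _, le_rfl, one_pos, le_rfl, fun _ _ => by simp⟩
  obtain ⟨Ξ, -, -, -, hΞ⟩ := exists_stationary
    (fun z => ⟨Set.univ, Set.finite_univ, by simp⟩) hirr haper hL
  rw [eq_of_invariant_of_tendsto hm (hΞ m measure_univ),
    eq_of_invariant_of_tendsto hm' (hΞ m' measure_univ)]

/-- The steady state at a fixed load, and the distance of `2 ε E[q]` from its heavy-traffic
value. -/
theorem exists_steadyState (hS : ∀ᵐ s ∂ν, s ≤ Smax) (hμ : ∫ s : ℕ, (s : ℝ) ∂ν = μ) (hε : 0 < ε)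
    {σs2 : ℝ} (hσs : Var[fun s : ℕ => (s : ℝ); ν] = σs2)
    (hP_irr : IsIrreducibleOn P Set.univ) (hP_aper : IsAperiodicOn P Set.univ)
    {π : Measure Ω} [IsProbabilityMeasure π] (hπ : P.Invariant π)
    {S : Set (ℕ × Ω)} (hQ_irr : IsIrreducibleOn (queueKernel P f ν) S)
    (hQ_aper : IsAperiodicOn (queueKernel P f ν) S)
    {B α : ℝ} (hα0 : 0 ≤ α) (hα1 : α < 1) (hB0 : 0 ≤ B)
    (hB : ∀ t x, |meanDev P f (μ - ε) t x| ≤ B * α ^ t) :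
    IsPositiveRecurrentOn (queueKernel P f ν) S ∧
    ∃ ρ : ProbabilityMeasure ℕ,
      (∃ Ξ : ProbabilityMeasure (ℕ × Ω),
        (queueKernel P f ν).Invariant (Ξ : Measure (ℕ × Ω)) ∧
        (Ξ : Measure (ℕ × Ω)) S = 1 ∧
        (Ξ : Measure (ℕ × Ω)).map Prod.fst = (ρ : Measure ℕ)) ∧
      (∀ ν₀ : ProbabilityMeasure (ℕ × Ω), (ν₀ : Measure (ℕ × Ω)) S = 1 →
        TendstoInDistribution (fun (t : ℕ) (ω : ℕ → ℕ × Ω) => (ω t).1) atTop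
          (fun q : ℕ => q)
          (fun _ => chainLaw (queueKernel P f ν) (ν₀ : Measure (ℕ × Ω)))
          (ρ : Measure ℕ)) ∧
      Integrable (fun q : ℕ => (q : ℝ)) (ρ : Measure ℕ) ∧
      |2 * ε * ∫ q : ℕ, (q : ℝ) ∂(ρ : Measure ℕ) - (σs2 + ε ^ 2 +
        (autocorr P f π (μ - ε) 0 + 2 * ∑' t, autocorr P f π (μ - ε) (t + 1)))| ≤
          (4 * (B / (1 - α)) + Smax) * ε := by
  set h := poissonSol P f (μ - ε)
  have hh := poissonSol_sub hα0 hα1 hB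
  have hH := abs_poissonSol_le hα0 hα1 hB
  set H := B / (1 - α)
  have hH0 : 0 ≤ H := div_nonneg hB0 (by linarith)
  obtain ⟨θ, γ, b, hθ, hL⟩ := exists_isGeometricLyapunov hS hμ hε hh hH0 hH S
  obtain ⟨Ξ, hinv, hΞS, hLi, hconv⟩ :=
    exists_stationary isFinitelySupported_queueKernel hQ_irr hQ_aper hL
  have hsq : Integrable (fun z : ℕ × Ω => (z.1 : ℝ) ^ 2) (Ξ : Measure (ℕ × Ω)) := by
    refine (hLi.const_mul (2 / θ ^ 2 * Real.exp (θ * H))).mono'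
      Measurable.of_discrete.aestronglyMeasurable (ae_of_all _ fun z => ?_)
    rw [Real.norm_of_nonneg (sq_nonneg _), mul_assoc, ← Real.exp_add]
    have hq0 : (0 : ℝ) ≤ z.1 := Nat.cast_nonneg _
    have h1 := Real.quadratic_le_exp_of_nonneg (mul_nonneg hθ.le hq0)
    have h2 : Real.exp (θ * z.1) ≤ Real.exp (θ * H + θ * (z.1 + h z.2)) := by
      rw [Real.exp_le_exp]
      have := mul_le_mul_of_nonneg_left (abs_le.1 (hH z.2)).1 hθ.le
      linarith
    have h3 : (θ * z.1) ^ 2 / 2 ≤ Real.exp (θ * H + θ * (z.1 + h z.2)) := by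
      have := mul_nonneg hθ.le hq0
      linarith
    calc (z.1 : ℝ) ^ 2 = 2 / θ ^ 2 * ((θ * z.1) ^ 2 / 2) := by field_simp
      _ ≤ _ := mul_le_mul_of_nonneg_left h3 (by positivity)
  have hmarg : (Ξ : Measure (ℕ × Ω)).map Prod.snd = π := by
    have : IsProbabilityMeasure ((Ξ : Measure (ℕ × Ω)).map Prod.snd) :=
      Measure.isProbabilityMeasure_map measurable_snd.aemeasurable
    exact invariant_unique_of_fintype hP_irr hP_aper (invariant_map_snd hinv) hπ
  have hest := abs_integral_queue_sub_le hS hμ hε hh hH hσs hinv hsq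
  rw [hmarg, integral_condVar_poissonSol hα0 hα1 hB hπ] at hest
  have hqi : Integrable (fun z : ℕ × Ω => (z.1 : ℝ)) (Ξ : Measure (ℕ × Ω)) := by
    refine ((integrable_const 1).add hsq).mono' Measurable.of_discrete.aestronglyMeasurable
      (ae_of_all _ fun z => ?_)
    rw [Real.norm_of_nonneg (Nat.cast_nonneg _)]
    simp only [Pi.add_apply]
    nlinarith [sq_nonneg ((z.1 : ℝ) - 1)]
  obtain ⟨ρ, hρ⟩ : ∃ ρ : ProbabilityMeasure ℕ,
      (Ξ : Measure (ℕ × Ω)).map Prod.fst = (ρ : Measure ℕ) :=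
    ⟨⟨_, Measure.isProbabilityMeasure_map measurable_fst.aemeasurable⟩, rfl⟩
  refine ⟨isPositiveRecurrentOn_of_invariant hQ_irr hinv (by rw [hΞS]; exact one_ne_zero),
    ρ, ⟨Ξ, hinv, hΞS, hρ⟩, fun ν₀ hν₀ => ?_, ?_, ?_⟩
  · refine ⟨fun t => (show Measurable fun ω : ℕ → ℕ × Ω => (ω t).1 by fun_prop).aemeasurable,
      measurable_id.aemeasurable, ?_⟩
    refine ProbabilityMeasure.tendsto_iff_forall_integral_tendsto.2 fun φ => ?_
    have h1 := hconv (ν₀ : Measure (ℕ × Ω)) hν₀ (fun z => φ z.1) ‖φ‖ fun z => φ.norm_coe_le_norm _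
    simp only [ProbabilityMeasure.coe_mk]
    rw [Measure.map_id',
      ← hρ, integral_map measurable_fst.aemeasurable Measurable.of_discrete.aestronglyMeasurable]
    refine h1.congr fun t => ?_
    rw [← map_nth_chainLaw, integral_map (measurable_pi_apply t).aemeasurable
      Measurable.of_discrete.aestronglyMeasurable, integral_map
      (show Measurable fun ω : ℕ → ℕ × Ω => (ω t).1 by fun_prop).aemeasurable
      Measurable.of_discrete.aestronglyMeasurable]
  · rw [← hρ]
    exact (integrable_map_measure Measurable.of_discrete.aestronglyMeasurable
      measurable_fst.aemeasurable).2 hqi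
  · rw [← hρ, integral_map measurable_fst.aemeasurable Measurable.of_discrete.aestronglyMeasurable]
    exact hest

end SteadyState

end MarkovQueue

/-! ### The heavy-traffic limit -/

theorem mainTheorem3
    -- the i.i.d. bounded potential service: law, mean and variance
    (ν : Measure ℕ) [IsProbabilityMeasure ν] (Smax : ℕ) (hS : ∀ᵐ s ∂ν, s ≤ Smax)
    (μ σs2 : ℝ) (hμ : ∫ s : ℕ, (s : ℝ) ∂ν = μ) (hμ_pos : 0 < μ)
    (hσs : Var[fun s : ℕ => (s : ℝ); ν] = σs2)
    -- the modulating chains on finite state spaces, with their stationary distributions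
    (Ω : ℝ → Type*) [∀ ε, Fintype (Ω ε)] [∀ ε, MeasurableSpace (Ω ε)]
    [∀ ε, MeasurableSingletonClass (Ω ε)]
    (P : ∀ ε, Kernel (Ω ε) (Ω ε)) [∀ ε, IsMarkovKernel (P ε)]
    (hP_irr : ∀ ε ∈ Set.Ioo 0 μ, IsIrreducibleOn (P ε) Set.univ)
    (hP_aper : ∀ ε ∈ Set.Ioo 0 μ, IsAperiodicOn (P ε) Set.univ)
    (π : ∀ ε, Measure (Ω ε)) (hπ_prob : ∀ ε ∈ Set.Ioo 0 μ, IsProbabilityMeasure (π ε))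
    (hπ_inv : ∀ ε ∈ Set.Ioo 0 μ, (P ε).Invariant (π ε))
    -- the arrivals: uniformly bounded, with rate `μ - ε`
    (f : ∀ ε, Ω ε → ℕ) (Amax : ℕ) (hA : ∀ ε ∈ Set.Ioo 0 μ, ∀ x, f ε x ≤ Amax)
    (hrate : ∀ ε ∈ Set.Ioo 0 μ, ∫ x, (f ε x : ℝ) ∂(π ε) = μ - ε)
    -- the queue, an irreducible and aperiodic chain on its state space `S ε`
    (S : ∀ ε, Set (ℕ × Ω ε))
    (hQ_irr : ∀ ε ∈ Set.Ioo 0 μ, IsIrreducibleOn (queueKernel (P ε) (f ε) ν) (S ε))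
    (hQ_aper : ∀ ε ∈ Set.Ioo 0 μ, IsAperiodicOn (queueKernel (P ε) (f ε) ν) (S ε))
    -- the geometric mixing parameters, and their uniform bounds
    (α C : ℝ → ℝ) (hα : ∀ ε ∈ Set.Ioo 0 μ, α ε ∈ Set.Ioo 0 1)
    (hC : ∀ ε ∈ Set.Ioo 0 μ, 0 < C ε)
    (hmix : ∀ ε ∈ Set.Ioo 0 μ, GeometricMixing (P ε) (f ε) (μ - ε) (α ε) (C ε))
    (α₀ C₀ : ℝ) (hα₀ : α₀ < 1) (hα_le : ∀ ε ∈ Set.Ioo 0 μ, α ε ≤ α₀)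
    (hC_le : ∀ ε ∈ Set.Ioo 0 μ, C ε ≤ C₀)
    -- the autocorrelations converge
    (γ : ℕ → ℝ)
    (hγ : ∀ t, Tendsto (fun ε => autocorr (P ε) (f ε) (π ε) (μ - ε) t) (𝓝[>] 0) (𝓝 (γ t))) :
    (∀ ε ∈ Set.Ioo 0 μ, IsPositiveRecurrentOn (queueKernel (P ε) (f ε) ν) (S ε)) ∧
    -- `ρ ε` is the law of the steady-state queue length, `σa2` the asymptotic variance
    ∃ (ρ : ℝ → ProbabilityMeasure ℕ) (σa2 : ℝ),
      (∀ ε ∈ Set.Ioo 0 μ,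
        (∃ Ξ : ProbabilityMeasure (ℕ × Ω ε),
          (queueKernel (P ε) (f ε) ν).Invariant (Ξ : Measure (ℕ × Ω ε)) ∧
          (Ξ : Measure (ℕ × Ω ε)) (S ε) = 1 ∧
          (Ξ : Measure (ℕ × Ω ε)).map Prod.fst = (ρ ε : Measure ℕ)) ∧
        (∀ ν₀ : ProbabilityMeasure (ℕ × Ω ε), (ν₀ : Measure (ℕ × Ω ε)) (S ε) = 1 →
          TendstoInDistribution (fun (t : ℕ) (ω : ℕ → ℕ × Ω ε) => (ω t).1) atTop
            (fun q : ℕ => q)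
            (fun _ => chainLaw (queueKernel (P ε) (f ε) ν) (ν₀ : Measure (ℕ × Ω ε)))
            (ρ ε : Measure ℕ)) ∧
        Integrable (fun q : ℕ => (q : ℝ)) (ρ ε : Measure ℕ)) ∧
      Tendsto (fun m : ℕ => γ 0 + 2 * ∑ t ∈ Finset.Icc 1 m, γ t) atTop (𝓝 σa2) ∧
      Tendsto (fun ε => ∫ q : ℕ, ε * (q : ℝ) ∂(ρ ε : Measure ℕ)) (𝓝[>] 0)
        (𝓝 ((σa2 + σs2) / 2)) := by
  have hmid : μ / 2 ∈ Set.Ioo 0 μ := ⟨by linarith, by linarith⟩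
  have hα₀0 : 0 < α₀ := (hα _ hmid).1.trans_le (hα_le _ hmid)
  have hC₀0 : 0 < C₀ := (hC _ hmid).trans_le (hC_le _ hmid)
  set B : ℝ := Amax + μ + 2 * Amax * C₀ with hBdef
  have hB0 : 0 ≤ B := by positivity
  -- the correlations of the arrivals decay geometrically, uniformly in `ε`
  have hB : ∀ ε ∈ Set.Ioo 0 μ, ∀ t x, |meanDev (P ε) (f ε) (μ - ε) t x| ≤ B * α₀ ^ t := by
    intro ε hε t x
    rcases Nat.eq_zero_or_pos t with rfl | ht
    · rw [meanDev_zero, pow_zero, mul_one]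
      have h1 : (f ε x : ℝ) ≤ Amax := Nat.cast_le.2 (hA ε hε x)
      have h2 : (0 : ℝ) ≤ f ε x := Nat.cast_nonneg _
      have h3 : 0 ≤ 2 * (Amax : ℝ) * C₀ := by positivity
      exact abs_le.2 ⟨by linarith [hε.1, hε.2], by linarith [hε.1, hε.2]⟩
    · refine ((hmix ε hε).abs_meanDev_le _ _ _ ht x).trans ?_
      have h1 : ((Finset.univ.sup (f ε) : ℕ) : ℝ) ≤ Amax :=
        Nat.cast_le.2 (Finset.sup_le fun x _ => hA ε hε x)
      have h2 : (α ε) ^ t ≤ α₀ ^ t := pow_le_pow_left₀ (hα ε hε).1.le (hα_le ε hε) t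
      have h3 := (hα ε hε).1
      have h4 := hC ε hε
      calc 2 * ((Finset.univ.sup (f ε) : ℕ) : ℝ) * C ε * α ε ^ t
          ≤ 2 * Amax * C₀ * α₀ ^ t := by
            gcongr
            exact hC_le ε hε
        _ ≤ B * α₀ ^ t := by
            gcongr
            rw [hBdef]
            linarith [Nat.cast_nonneg (α := ℝ) Amax]
  have hsteady := fun (ε : ℝ) (hε : ε ∈ Set.Ioo 0 μ) =>
    haveI := hπ_prob ε hε
    exists_steadyState (P := P ε) (f := f ε) hS hμ hε.1 hσs (hP_irr ε hε) (hP_aper ε hε)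
      (hπ_inv ε hε) (hQ_irr ε hε) (hQ_aper ε hε) hα₀0.le hα₀ hB0 (hB ε hε)
  refine ⟨fun ε hε => (hsteady ε hε).1, ?_⟩
  choose! ρ hρ using fun (ε : ℝ) (hε : ε ∈ Set.Ioo 0 μ) => (hsteady ε hε).2
  have hIoo : ∀ᶠ ε : ℝ in 𝓝[>] 0, ε ∈ Set.Ioo 0 μ := Ioo_mem_nhdsGT hμ_pos
  have hγε : ∀ ε ∈ Set.Ioo 0 μ, ∀ t,
      |autocorr (P ε) (f ε) (π ε) (μ - ε) t| ≤ B * B * α₀ ^ t := fun ε hε t =>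
    haveI := hπ_prob ε hε
    abs_autocorr_le hα₀0.le hB0 (hB ε hε) (π ε) t
  have hγb : ∀ t, |γ t| ≤ B * B * α₀ ^ t := fun t =>
    le_of_tendsto (hγ t).abs (hIoo.mono fun ε hε => hγε ε hε t)
  have hgeo : Summable fun t : ℕ => B * B * α₀ ^ (t + 1) :=
    (summable_nat_add_iff 1).2 ((summable_geometric_of_lt_one hα₀0.le hα₀).mul_left (B * B))
  have hγs : Summable fun t => γ (t + 1) := Summable.of_norm_bounded hgeo fun t => hγb (t + 1)
  refine ⟨ρ, γ 0 + 2 * ∑' t, γ (t + 1), fun ε hε => ?_, ?_, ?_⟩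
  · obtain ⟨h1, h2, h3, -⟩ := hρ ε hε
    exact ⟨h1, h2, h3⟩
  · have hIcc : ∀ m : ℕ, ∑ t ∈ Finset.Icc 1 m, γ t = ∑ t ∈ Finset.range m, γ (t + 1) := by
      intro m
      induction m with
      | zero => simp
      | succ m ih => rw [Finset.sum_Icc_succ_top (by omega), Finset.sum_range_succ, ih]
    simp_rw [hIcc]
    exact (hγs.hasSum.tendsto_sum_nat.const_mul 2).const_add _
  · have hid : Tendsto (fun ε : ℝ => ε) (𝓝[>] 0) (𝓝 0) := tendsto_id.mono_left nhdsWithin_le_nhds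
    have htsum : Tendsto (fun ε => ∑' t, autocorr (P ε) (f ε) (π ε) (μ - ε) (t + 1)) (𝓝[>] 0)
        (𝓝 (∑' t, γ (t + 1))) :=
      tendsto_tsum_of_dominated_convergence hgeo (fun t => hγ (t + 1))
        (hIoo.mono fun ε hε t => hγε ε hε (t + 1))
    have hvalue := ((tendsto_const_nhds (x := σs2)).add (hid.pow 2)).add
      ((hγ 0).add (htsum.const_mul 2))
    have herr : Tendsto (fun ε => 2 * ε * ∫ q : ℕ, (q : ℝ) ∂(ρ ε : Measure ℕ) - (σs2 + ε ^ 2 +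
        (autocorr (P ε) (f ε) (π ε) (μ - ε) 0 +
          2 * ∑' t, autocorr (P ε) (f ε) (π ε) (μ - ε) (t + 1)))) (𝓝[>] 0) (𝓝 0) := by
      refine squeeze_zero_norm' (hIoo.mono fun ε hε => (hρ ε hε).2.2.2) ?_
      simpa using hid.const_mul (4 * (B / (1 - α₀)) + (Smax : ℝ))
    have h := (herr.add hvalue).div_const 2
    have hlim : (0 + (σs2 + 0 ^ 2 + (γ 0 + 2 * ∑' t, γ (t + 1)))) / 2 =
        (γ 0 + 2 * ∑' t, γ (t + 1) + σs2) / 2 := by ring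
    rw [hlim] at h
    refine h.congr fun ε => ?_
    rw [sub_add_cancel, integral_const_mul]
    ring
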